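/- Let $p$ be a prime and let $K$ be a field with a non-Archimedean absolute value $|\cdot|$ such that $|p|=1/p$ (completeness of $K$ is not required). For $d\ge 0$ let $A=K\langle x_1,\dots,x_d,z\rangle$ be the ring of formal power series over $K$ in $x_1,\dots,x_d,z$ whose coefficients tend to $0$, and let $\mathcal M$ be a finitely generated $A$-module. For $c\in K$ write $\mathcal M|_{z=c}=\mathcal M/(z-c)\mathcal M$. Say that two sets agree up to finite sets if their symmetric difference is finite (that is, one is obtained from the other by adding and removing finite sets). Let $R$ be a subring of the valuation ring $\{c\in K: |c|\le 1\}$, with the topology and metric induced from $K$. Then the set $$\mathcal T_R=\{c\in R:\ \mathcal M|_{z=c}=0\}$$ is open in $R$. If $R$ is compact, then there exists $\varepsilon>0$ such that, up to finite sets, $\mathcal T_R$ is a union of balls $\{c\in R:|c-a|<\varepsilon\}$, $a\in R$, of the same radius $\varepsilon$. In particular, for $R=\mathbb Z$: there exists an integer $r\ge 0$ such that, up to finite sets, the set $\{n\in\mathbb Z:\ \mathcal M|_{z=n}=0\}$ is a (possibly empty) finite union of arithmetic progressions $b+p^r\mathbb Z$, $b\in\mathbb Z$, all with the same difference $p^r$.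 -/

import Mathlib

/-- The Tate algebra `K⟨x_i : i ∈ σ⟩` over a non-Archimedean normed field `K`: the subring of
`K⟦x_i : i ∈ σ⟧` of the power series whose coefficients tend to zero (along the cofinite filter on
multi-indices). `K` is not required to be complete. -/
abbrev TateAlgebra (K : Type*) [NormedField K] [IsUltrametricDist K] (σ : Type*) :
    Subring (MvPowerSeries σ K) :=
  MvPowerSeries.IsRestricted.subring (fun _ : σ => (1 : ℝ))

namespace TateAlgebra

variable {K : Type*} [NormedField K] [IsUltrametricDist K] {σ : Type*}

/-- The constant power series `c`, as an element of the Tate algebra. -/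
noncomputable def const (c : K) : TateAlgebra K σ :=
  ⟨MvPowerSeries.C c, MvPowerSeries.isRestricted_C _ c⟩

/-- The variable `x_i`, as an element of the Tate algebra. -/
noncomputable def var (i : σ) : TateAlgebra K σ :=
  ⟨MvPowerSeries.X i, MvPowerSeries.isRestricted_monomial _ (Finsupp.single i 1) 1⟩

/-- Membership in the Tate algebra means exactly that the coefficients tend to zero. -/
theorem mem_iff (f : MvPowerSeries σ K) :
    f ∈ TateAlgebra K σ ↔
      Filter.Tendsto (fun t : σ →₀ ℕ => ‖MvPowerSeries.coeff t f‖) Filter.cofinite (nhds 0) := by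
  change MvPowerSeries.IsRestricted _ f ↔ _
  simp [MvPowerSeries.IsRestricted, Finsupp.prod]

end TateAlgebra

/-- The fibre `M|_{z=c} = M / (z - c) M` of a module `M` over `K⟨x_1, …, x_d, z⟩`. The variables are
indexed by `Fin (d + 1)`, the last one being `z`. -/
abbrev FibreAt {K : Type*} [NormedField K] [IsUltrametricDist K] {d : ℕ}
    (M : Type*) [AddCommGroup M] [Module (TateAlgebra K (Fin (d + 1))) M] (c : K) : Type _ :=
  M ⧸ (Ideal.span {(TateAlgebra.var (Fin.last d) - TateAlgebra.const c :
    TateAlgebra K (Fin (d + 1)))} • (⊤ : Submodule (TateAlgebra K (Fin (d + 1))) M))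

/-- The set of `c : K` for which the fibre `M|_{z=c}` is the zero module. -/
def vanishingSet (K : Type*) [NormedField K] [IsUltrametricDist K] (d : ℕ)
    (M : Type*) [AddCommGroup M] [Module (TateAlgebra K (Fin (d + 1))) M] : Set K :=
  {c : K | Subsingleton (FibreAt (d := d) M c)}

/-- Two sets agree up to the addition and removal of finite sets. -/
def EqUpToFinite {α : Type*} (S T : Set α) : Prop :=
  (symmDiff S T).Finite

open Filter Topology

/-! By the determinant trick (`Module.subsingleton_quotient_smul_top_iff`) the fibre at `c` vanishes
exactly when the annihilator `I` of `M` and `z - c` generate the unit ideal, so only an ideal is at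
stake. The Tate algebra over `K` is dense in the one over the completion, and its elements mapping
close to `1` are units (`eq_top_of_map_ofTateAlgebra_eq_top`); hence the question can be studied
over a complete field. Openness is then immediate: moving `c` slightly in `1 = i + s (z - c)` leaves
a unit on the right.

The heart is `exists_forall_vanishesAt_or_forall_not`: for small `c ≠ 0`, either all fibres vanish
or none does. The proof is by induction on the number of variables `x`, with the radius of the
`z`-disc free to shrink. If `I = 0`, no fibre over the disc vanishes. Otherwise `I` contains some `z
^ m * g` with `g` nonzero on `z = 0`; since `z` is invertible modulo `z - c`, `g` may be added to
`I` (`vanishesAt_sup_span_iff`). After scaling and shrinking, `g` is at distance less than `1` from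
a polynomial in `x` whose nonzero coefficients are units (`exists_poly_close`). Nagata's
substitution and Weierstrass division (`exists_weierstrass_division`) make the quotient by `g`
finite over a series ring with one `x` fewer, and finiteness allows `I` to be replaced by its
contraction to that ring (`Ideal.comap_sup_span_eq_top_of_finite`). When no `x` is left, `g` is a
unit.

Translation carries this to every point of the disc. On a compact set, a finite subcover and its
Lebesgue number give one uniform radius, the finitely many centres being the exceptions
(`exists_finite_vanishesAt_iff`). For the integers this is applied to their closure in the
completion, which is compact because there are finitely many residues modulo each power of `p`. -/

/-- The restricted power series over `K` for the polyradius `c`, as a subalgebra of the ring of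
formal power series. -/
def restrictedSeries (K : Type*) [NormedField K] [IsUltrametricDist K] {σ : Type*}
    (c : σ → {r : ℝ // 0 < r}) : Subalgebra K (MvPowerSeries σ K) where
  __ := MvPowerSeries.IsRestricted.subring (R := K) (fun i => (c i : ℝ))
  algebraMap_mem' a := MvPowerSeries.isRestricted_C _ a

/-! ### The Gauss norm, density of polynomials, completeness. -/

namespace restrictedSeries

variable {K : Type*} [NormedField K] [IsUltrametricDist K] {σ : Type*}
  {c : σ → {r : ℝ // 0 < r}}

/-- The weight `c ^ t` of the multi-index `t`. -/
noncomputable def weight (c : σ → {r : ℝ // 0 < r}) (t : σ →₀ ℕ) : ℝ :=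
  t.prod fun i n => (c i : ℝ) ^ n

lemma weight_pos (t : σ →₀ ℕ) : 0 < weight c t :=
  Finset.prod_pos fun i _ => pow_pos (c i).2 _

lemma weight_nonneg (t : σ →₀ ℕ) : 0 ≤ weight c t := (weight_pos t).le

lemma weight_add (s t : σ →₀ ℕ) : weight c (s + t) = weight c s * weight c t :=
  Finsupp.prod_add_index' (fun _ => pow_zero _) fun _ _ _ => pow_add _ _ _

@[simp] lemma weight_zero : weight c 0 = 1 := Finsupp.prod_zero_index

@[simp] lemma weight_single (i : σ) (n : ℕ) : weight c (Finsupp.single i n) = (c i : ℝ) ^ n :=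
  Finsupp.prod_single_index (pow_zero _)

/-- The coefficient of a restricted power series. -/
def coeff (t : σ →₀ ℕ) (f : restrictedSeries K c) : K := MvPowerSeries.coeff t f.1

@[ext] lemma ext {f g : restrictedSeries K c} (h : ∀ t, coeff t f = coeff t g) : f = g :=
  Subtype.ext (MvPowerSeries.ext h)

lemma tendsto_coeff (f : restrictedSeries K c) :
    Tendsto (fun t => ‖coeff t f‖ * weight c t) cofinite (𝓝 0) := f.2

@[simp] lemma coeff_add (t : σ →₀ ℕ) (f g : restrictedSeries K c) :
    coeff t (f + g) = coeff t f + coeff t g := rfl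

@[simp] lemma coeff_sub (t : σ →₀ ℕ) (f g : restrictedSeries K c) :
    coeff t (f - g) = coeff t f - coeff t g := rfl

@[simp] lemma coeff_zero (t : σ →₀ ℕ) : coeff t (0 : restrictedSeries K c) = 0 := rfl

@[simp] lemma coeff_smul (t : σ →₀ ℕ) (a : K) (f : restrictedSeries K c) :
    coeff t (a • f) = a * coeff t f := rfl

lemma coeff_sum {ι : Type*} (t : σ →₀ ℕ) (s : Finset ι) (f : ι → restrictedSeries K c) :
    coeff t (∑ i ∈ s, f i) = ∑ i ∈ s, coeff t (f i) := by
  simp [coeff, AddSubmonoidClass.coe_finsetSum]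

/-- A restricted power series given by its coefficients. -/
def mk (F : (σ →₀ ℕ) → K) (hF : Tendsto (fun t => ‖F t‖ * weight c t) cofinite (𝓝 0)) :
    restrictedSeries K c := ⟨F, hF⟩

@[simp] lemma coeff_mk (F : (σ →₀ ℕ) → K)
    (hF : Tendsto (fun t => ‖F t‖ * weight c t) cofinite (𝓝 0)) (t : σ →₀ ℕ) :
    coeff t (mk F hF) = F t := rfl

lemma hasGaussNorm (f : restrictedSeries K c) :
    MvPowerSeries.HasGaussNorm (norm : K → ℝ) (fun i => (c i : ℝ)) f.1 := by
  have h : (fun t : σ →₀ ℕ => ‖coeff t f‖ * weight c t) =O[cofinite] (1 : (σ →₀ ℕ) → ℝ) :=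
    (tendsto_coeff f).isBigO_one ℝ
  obtain ⟨C, hC⟩ := (Asymptotics.isBigO_cofinite_iff (by simp)).1 h
  refine ⟨C, ?_⟩
  rintro _ ⟨t, rfl⟩
  refine (Real.le_norm_self _).trans ?_
  simpa only [Pi.one_apply, norm_one, mul_one, coeff, weight] using hC t

/-- The Gauss norm as a ring norm. -/
noncomputable def ringNorm (K : Type*) [NormedField K] [IsUltrametricDist K] {σ : Type*}
    (c : σ → {r : ℝ // 0 < r}) : RingNorm (restrictedSeries K c) where
  toFun f := MvPowerSeries.gaussNorm (norm : K → ℝ) (fun i => (c i : ℝ)) f.1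
  map_zero' := MvPowerSeries.gaussNorm_zero _ _ norm_zero
  add_le' f g := (MvPowerSeries.gaussNorm_add_le_max _ _ _ _ (fun i => (c i).2.le)
    (fun _ => norm_nonneg _) IsUltrametricDist.isNonarchimedean_norm (hasGaussNorm f)
    (hasGaussNorm g)).trans (max_le_add_of_nonneg
      (MvPowerSeries.gaussNorm_nonneg _ _ _ fun _ => norm_nonneg _)
      (MvPowerSeries.gaussNorm_nonneg _ _ _ fun _ => norm_nonneg _))
  neg' _ := MvPowerSeries.gaussNorm_neg _ _ norm_neg _
  mul_le' f g := MvPowerSeries.gaussNorm_mul_le _ _ _ _ (fun i => (c i).2.le)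
    (fun _ => norm_nonneg _) (fun _ _ => norm_mul_le _ _)
    IsUltrametricDist.isNonarchimedean_norm norm_zero (hasGaussNorm f) (hasGaussNorm g)
  eq_zero_of_map_eq_zero' f hf := Subtype.ext ((MvPowerSeries.gaussNorm_eq_zero_iff _ _ _ norm_zero
    (fun _ => norm_nonneg _) (fun _ => norm_eq_zero.1) (fun i => (c i).2) (hasGaussNorm f)).1 hf)

noncomputable instance : NormedCommRing (restrictedSeries K c) where
  __ := (ringNorm K c).toNormedRing
  mul_comm := mul_comm

lemma norm_coeff_mul_le (t : σ →₀ ℕ) (f : restrictedSeries K c) :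
    ‖coeff t f‖ * weight c t ≤ ‖f‖ :=
  MvPowerSeries.le_gaussNorm _ _ _ (hasGaussNorm f) t

lemma norm_le {f : restrictedSeries K c} {C : ℝ} (h : ∀ t, ‖coeff t f‖ * weight c t ≤ C) :
    ‖f‖ ≤ C := ciSup_le h

/-- The supremum is attained up to the threshold `C / 2`: only finitely many terms exceed it, so
strictness survives. -/
lemma norm_lt {f : restrictedSeries K c} {C : ℝ} (hC : 0 < C)
    (h : ∀ t, ‖coeff t f‖ * weight c t < C) : ‖f‖ < C := by
  have hfin : {t | ¬ ‖coeff t f‖ * weight c t < C / 2}.Finite :=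
    (tendsto_coeff f).eventually_lt_const (half_pos hC)
  obtain ⟨D, hD, hD'⟩ : ∃ D < C, ∀ t ∈ hfin.toFinset, ‖coeff t f‖ * weight c t ≤ D := by
    obtain he | he := hfin.toFinset.eq_empty_or_nonempty
    · exact ⟨0, hC, fun t ht => by rw [he] at ht; simp at ht⟩
    · obtain ⟨s, -, hs⟩ := hfin.toFinset.exists_max_image (fun t => ‖coeff t f‖ * weight c t) he
      exact ⟨_, h s, hs⟩
  refine (norm_le (C := max D (C / 2)) fun t => ?_).trans_lt (max_lt hD (half_lt_self hC))
  by_cases ht : ‖coeff t f‖ * weight c t < C / 2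
  · exact ht.le.trans (le_max_right _ _)
  · exact (hD' t (by simpa using ht)).trans (le_max_left _ _)

instance : IsUltrametricDist (restrictedSeries K c) :=
  IsUltrametricDist.isUltrametricDist_of_forall_norm_add_le_max_norm fun f g =>
    MvPowerSeries.gaussNorm_add_le_max _ _ _ _ (fun i => (c i).2.le)
      (fun _ => norm_nonneg _) IsUltrametricDist.isNonarchimedean_norm
      (hasGaussNorm f) (hasGaussNorm g)

noncomputable instance : NormedAlgebra K (restrictedSeries K c) where
  norm_smul_le a f := norm_le fun t => by
    rw [coeff_smul, norm_mul, mul_assoc]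
    exact mul_le_mul_of_nonneg_left (norm_coeff_mul_le t f) (norm_nonneg a)

/-- The monomial `a x ^ t` as a restricted power series. -/
noncomputable def monomial (t : σ →₀ ℕ) (a : K) : restrictedSeries K c :=
  ⟨MvPowerSeries.monomial t a, MvPowerSeries.isRestricted_monomial _ t a⟩

lemma coeff_monomial [DecidableEq σ] (s t : σ →₀ ℕ) (a : K) :
    coeff s (monomial t a : restrictedSeries K c) = if s = t then a else 0 :=
  MvPowerSeries.coeff_monomial s t a

lemma monomial_mul_monomial (s t : σ →₀ ℕ) (a b : K) :
    (monomial s a * monomial t b : restrictedSeries K c) = monomial (s + t) (a * b) :=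
  Subtype.ext (MvPowerSeries.monomial_mul_monomial s t a b)

lemma monomial_zero_one : (monomial 0 1 : restrictedSeries K c) = 1 :=
  Subtype.ext MvPowerSeries.monomial_zero_one

lemma monomial_eq_smul (t : σ →₀ ℕ) (a : K) :
    (monomial t a : restrictedSeries K c) = a • monomial t 1 := by
  classical
  ext s
  simp [coeff_monomial]

lemma norm_monomial (t : σ →₀ ℕ) (a : K) :
    ‖(monomial t a : restrictedSeries K c)‖ = ‖a‖ * weight c t := by
  classical
  refine le_antisymm (norm_le fun s => ?_) ?_
  · rw [coeff_monomial]
    split_ifs with h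
    · rw [h]
    · simpa using mul_nonneg (norm_nonneg a) (weight_nonneg t)
  · simpa [coeff_monomial] using norm_coeff_mul_le t (monomial t a : restrictedSeries K c)

instance : NormOneClass (restrictedSeries K c) where
  norm_one := by rw [← monomial_zero_one, norm_monomial]; simp

/-- The variable `x_i` as a restricted power series. -/
noncomputable def X (i : σ) : restrictedSeries K c := monomial (Finsupp.single i 1) 1

lemma X_pow (i : σ) (n : ℕ) :
    (X i : restrictedSeries K c) ^ n = monomial (Finsupp.single i n) 1 := by
  induction n with
  | zero => simp [monomial_zero_one]
  | succ n ih => rw [pow_succ, ih, X, monomial_mul_monomial, one_mul, Finsupp.single_add]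

lemma norm_X (i : σ) : ‖(X i : restrictedSeries K c)‖ = c i := by
  simp [X, norm_monomial]

lemma monomial_eq_prod (t : σ →₀ ℕ) :
    (monomial t 1 : restrictedSeries K c) = t.prod fun i n => X i ^ n := by
  induction t using Finsupp.induction_linear with
  | zero => simp [monomial_zero_one]
  | add s t hs ht =>
    rw [Finsupp.prod_add_index' (fun _ => pow_zero _) fun _ _ _ => pow_add _ _ _, ← hs, ← ht,
      monomial_mul_monomial, one_mul]
  | single i n => rw [Finsupp.prod_single_index (h := fun i n => X i ^ n) (pow_zero _), X_pow]

lemma hasSum_monomial (f : restrictedSeries K c) : HasSum (fun t => monomial t (coeff t f)) f := by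
  classical
  rw [HasSum, Metric.tendsto_nhds]
  intro ε hε
  have hfin : {t | ¬ ‖coeff t f‖ * weight c t < ε}.Finite :=
    (tendsto_coeff f).eventually_lt_const hε
  filter_upwards [eventually_ge_atTop hfin.toFinset] with s hs
  rw [dist_comm, dist_eq_norm]
  refine norm_lt hε fun t => ?_
  rw [coeff_sub, coeff_sum]
  simp only [coeff_monomial, Finset.sum_ite_eq]
  split_ifs with h
  · simpa using hε
  · rw [sub_zero]
    by_contra h'
    exact h (hs (by simpa using h'))

/-- This is the workhorse for identities below: each is checked on monomials and extended by
continuity. -/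
lemma addMonoidHom_ext {B : Type*} [AddCommMonoid B] [TopologicalSpace B] [T2Space B]
    {φ ψ : restrictedSeries K c →+ B} (hφ : Continuous φ) (hψ : Continuous ψ)
    (h : ∀ t a, φ (monomial t a) = ψ (monomial t a)) : φ = ψ := by
  ext f
  refine ((hasSum_monomial f).map φ hφ).unique ?_
  rw [show φ ∘ (fun t => monomial t (coeff t f)) = ψ ∘ fun t => monomial t (coeff t f) from
    funext fun t => h _ _]
  exact (hasSum_monomial f).map ψ hψ

lemma tendsto_of_norm_sub_le {F : (σ →₀ ℕ) → K}
    (h : ∀ ε > 0, ∃ f : restrictedSeries K c, ∀ t, ‖F t - coeff t f‖ * weight c t ≤ ε) :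
    Tendsto (fun t => ‖F t‖ * weight c t) cofinite (𝓝 0) := by
  refine Metric.tendsto_nhds.2 fun ε hε => ?_
  obtain ⟨f, hf⟩ := h (ε / 2) (half_pos hε)
  filter_upwards [(tendsto_coeff f).eventually_lt_const hε] with t ht
  rw [Real.dist_0_eq_abs, abs_of_nonneg (mul_nonneg (norm_nonneg _) (weight_nonneg t))]
  have h1 : ‖F t‖ ≤ max ‖F t - coeff t f‖ ‖coeff t f‖ := by
    simpa using IsUltrametricDist.norm_add_le_max (F t - coeff t f) (coeff t f)
  refine (mul_le_mul_of_nonneg_right h1 (weight_nonneg t)).trans_lt ?_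
  rw [max_mul_of_nonneg _ _ (weight_nonneg t)]
  exact max_lt ((hf t).trans_lt (half_lt_self hε)) ht

instance [CompleteSpace K] : CompleteSpace (restrictedSeries K c) := by
  refine Metric.complete_of_cauchySeq_tendsto fun u hu => ?_
  have hcoeff (t : σ →₀ ℕ) (f g : restrictedSeries K c) :
      ‖coeff t f - coeff t g‖ * weight c t ≤ dist f g := by
    rw [dist_eq_norm, ← coeff_sub]
    exact norm_coeff_mul_le t _
  have hc (t : σ →₀ ℕ) : CauchySeq fun n => coeff t (u n) := by
    rw [Metric.cauchySeq_iff'] at hu ⊢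
    intro ε hε
    obtain ⟨N, hN⟩ := hu (ε * weight c t) (mul_pos hε (weight_pos t))
    refine ⟨N, fun n hn => ?_⟩
    rw [dist_eq_norm]
    exact lt_of_mul_lt_mul_right ((hcoeff t _ _).trans_lt (hN n hn)) (weight_nonneg t)
  choose F hF using fun t => cauchySeq_tendsto_of_complete (hc t)
  -- The convergence of coefficients is uniform in `t`; this gives both that the limit is restricted
  -- and that it is a limit in norm.
  have key : ∀ ε > 0, ∃ N, ∀ n ≥ N, ∀ t, ‖F t - coeff t (u n)‖ * weight c t ≤ ε := by
    intro ε hε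
    obtain ⟨N, hN⟩ := Metric.cauchySeq_iff.1 hu ε hε
    refine ⟨N, fun n hn t => ?_⟩
    refine le_of_tendsto ((((hF t).sub_const _).norm).mul_const _) ?_
    filter_upwards [eventually_ge_atTop N] with m hm
    exact (hcoeff t _ _).trans (hN m hm n hn).le
  have hF' := tendsto_of_norm_sub_le (F := F) fun ε hε => by
    obtain ⟨N, hN⟩ := key ε hε
    exact ⟨u N, hN N le_rfl⟩
  refine ⟨mk F hF', Metric.tendsto_atTop.2 fun ε hε => ?_⟩
  obtain ⟨N, hN⟩ := key (ε / 2) (half_pos hε)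
  refine ⟨N, fun n hn => ?_⟩
  rw [dist_comm, dist_eq_norm]
  exact (norm_le fun t => hN n hn t).trans_lt (half_lt_self hε)

/-! ### Bounded linear extension and evaluation homomorphisms. -/

section LinearExtension

variable {B : Type*} [NormedAddCommGroup B] [NormedSpace K B]
  [IsUltrametricDist B] [CompleteSpace B]

lemma summable_smul (q : (σ →₀ ℕ) → B) {C : ℝ} (hq : ∀ t, ‖q t‖ ≤ C * weight c t)
    (f : restrictedSeries K c) : Summable fun t => coeff t f • q t := by
  refine NonarchimedeanAddGroup.summable_of_tendsto_cofinite_zero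
    (squeeze_zero_norm (a := fun t => C * (‖coeff t f‖ * weight c t)) (fun t => ?_) ?_)
  · rw [norm_smul]
    exact (mul_le_mul_of_nonneg_left (hq t) (norm_nonneg _)).trans_eq (by ring)
  · simpa using (tendsto_coeff f).const_mul C

/-- The continuous linear map sending `x ^ t` to `q t`, for a bounded family `q`. -/
noncomputable def lift (q : (σ →₀ ℕ) → B) {C : ℝ} (hq : ∀ t, ‖q t‖ ≤ C * weight c t) :
    restrictedSeries K c →ₗ[K] B where
  toFun f := ∑' t, coeff t f • q t
  map_add' f g := by
    rw [← (summable_smul q hq f).tsum_add (summable_smul q hq g)]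
    simp [add_smul]
  map_smul' a f := by
    simp only [coeff_smul, mul_smul, RingHom.id_apply]
    exact (summable_smul q hq f).tsum_const_smul a

variable (q : (σ →₀ ℕ) → B) {C : ℝ} (hq : ∀ t, ‖q t‖ ≤ C * weight c t)

lemma lift_monomial (t : σ →₀ ℕ) (a : K) : lift q hq (monomial t a) = a • q t := by
  classical
  refine (tsum_eq_single t fun s hs => ?_).trans ?_
  · simp [coeff_monomial, hs]
  · simp [coeff_monomial]

lemma norm_lift_le (f : restrictedSeries K c) : ‖lift q hq f‖ ≤ C * ‖f‖ := by
  have hC : 0 ≤ C := by simpa using (norm_nonneg _).trans (hq 0)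
  refine IsUltrametricDist.norm_tsum_le_of_forall_le_of_nonneg
    (mul_nonneg hC (norm_nonneg f)) fun t => ?_
  rw [norm_smul]
  calc _ ≤ ‖coeff t f‖ * (C * weight c t) := mul_le_mul_of_nonneg_left (hq t) (norm_nonneg _)
    _ = C * (‖coeff t f‖ * weight c t) := by ring
    _ ≤ _ := mul_le_mul_of_nonneg_left (norm_coeff_mul_le t f) hC

lemma continuous_lift : Continuous (lift (K := K) q hq) :=
  AddMonoidHomClass.continuous_of_bound (lift (K := K) q hq) C (norm_lift_le q hq)

end LinearExtension

lemma norm_prod_pow_le {B : Type*} [NormedCommRing B] [NormOneClass B] {b : σ → B}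
    (hb : ∀ i, ‖b i‖ ≤ c i) (t : σ →₀ ℕ) :
    ‖t.prod fun i n => b i ^ n‖ ≤ 1 * weight c t := by
  rw [one_mul]
  refine (Finset.norm_prod_le _ _).trans
    (Finset.prod_le_prod (fun _ _ => norm_nonneg _) fun i _ => (norm_pow_le _ _).trans ?_)
  exact pow_le_pow_left₀ (norm_nonneg _) (hb i) _

lemma algHom_ext {B : Type*} [NormedCommRing B] [NormedAlgebra K B]
    {φ ψ : restrictedSeries K c →ₐ[K] B} (hφ : Continuous φ) (hψ : Continuous ψ)
    (h : ∀ i, φ (X i) = ψ (X i)) : φ = ψ := by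
  have := addMonoidHom_ext (φ := (φ : restrictedSeries K c →+ B))
    (ψ := (ψ : restrictedSeries K c →+ B)) hφ hψ fun t a => by
      rw [monomial_eq_smul, monomial_eq_prod, Finsupp.prod]
      simp [h]
  exact AlgHom.ext fun f => DFunLike.congr_fun this f

section Evaluation

variable {B : Type*} [NormedCommRing B] [NormedAlgebra K B] [NormOneClass B]
  [IsUltrametricDist B] [CompleteSpace B]

/-- Evaluation of restricted power series: the continuous algebra map sending `x_i` to `b i`. -/
noncomputable def eval (b : σ → B) (hb : ∀ i, ‖b i‖ ≤ c i) : restrictedSeries K c →ₐ[K] B :=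
  AlgHom.ofLinearMap (lift (fun t => t.prod fun i n => b i ^ n) (norm_prod_pow_le hb))
    (by rw [← monomial_zero_one, lift_monomial]; simp) <| by
  set L := lift (K := K) (c := c) (fun t => t.prod fun i n => b i ^ n) (norm_prod_pow_le hb)
  have hL : Continuous L := continuous_lift _ _
  -- Multiplicativity by density in one factor at a time: here the left factor is still a monomial.
  have h1 (s : σ →₀ ℕ) (a : K) (g : restrictedSeries K c) :
      L (monomial s a * g) = L (monomial s a) * L g := by
    refine DFunLike.congr_fun (addMonoidHom_ext
      (φ := L.toAddMonoidHom.comp (AddMonoidHom.mulLeft (monomial s a)))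
      (ψ := (AddMonoidHom.mulLeft (L (monomial s a))).comp L.toAddMonoidHom)
      (hL.comp (continuous_const_mul _)) ((continuous_const_mul _).comp hL) fun t b => ?_) g
    change L (monomial s a * monomial t b) = L (monomial s a) * L (monomial t b)
    rw [monomial_mul_monomial, lift_monomial, lift_monomial, lift_monomial,
      Finsupp.prod_add_index' (fun _ => pow_zero _) fun _ _ _ => pow_add _ _ _,
      smul_mul_smul_comm]
  intro f g
  exact DFunLike.congr_fun (addMonoidHom_ext
    (φ := L.toAddMonoidHom.comp (AddMonoidHom.mulRight g))
    (ψ := (AddMonoidHom.mulRight (L g)).comp L.toAddMonoidHom)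
    (hL.comp (continuous_mul_const _)) ((continuous_mul_const _).comp hL) fun t b => h1 t b g) f

variable (b : σ → B) (hb : ∀ i, ‖b i‖ ≤ c i)

lemma eval_monomial (t : σ →₀ ℕ) (a : K) :
    eval b hb (monomial t a) = a • t.prod fun i n => b i ^ n :=
  lift_monomial _ (norm_prod_pow_le hb) t a

@[simp] lemma eval_X (i : σ) : eval (K := K) b hb (X i) = b i := by
  rw [X, eval_monomial, Finsupp.prod_single_index (h := fun i n => b i ^ n) (pow_zero _), one_smul,
    pow_one]

lemma norm_eval_le (f : restrictedSeries K c) : ‖eval b hb f‖ ≤ ‖f‖ :=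
  (norm_lift_le _ (norm_prod_pow_le hb) f).trans_eq (one_mul _)

lemma continuous_eval : Continuous (eval (K := K) b hb) :=
  continuous_lift _ (norm_prod_pow_le hb)

end Evaluation

end restrictedSeries

/-! ### Unit ideals modulo one element; contractions. -/

/-- If the image of an ideal `I` in a finite `R`-algebra quotient becomes everything modulo `a : R`,
so does the contraction of `I` to `R`. -/
theorem Ideal.comap_sup_span_eq_top_of_finite {R S : Type*} [CommRing R] [CommRing S]
    (φ : R →+* S) (I : Ideal S) (hfin : ((Ideal.Quotient.mk I).comp φ).Finite) {a : R}
    (h : I ⊔ Ideal.span {φ a} = ⊤) : I.comap φ ⊔ Ideal.span {a} = ⊤ := by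
  let : Algebra R (S ⧸ I) := ((Ideal.Quotient.mk I).comp φ).toAlgebra
  have : Module.Finite R (S ⧸ I) := hfin
  have hsmul (r : R) (s : S) : r • (Ideal.Quotient.mk I s) = Ideal.Quotient.mk I (φ r * s) := by
    rw [Algebra.smul_def, map_mul]; rfl
  obtain ⟨i, hi, b, hb, hib⟩ := Submodule.mem_sup.1 ((Ideal.eq_top_iff_one _).1 h)
  obtain ⟨s, rfl⟩ := Ideal.mem_span_singleton'.1 hb
  -- The hypothesis says that `a` acts surjectively on `S ⧸ I`, so Nakayama gives `r ≡ 1` modulo `a`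
  -- killing `S ⧸ I`; applied to `1`, this puts `φ r` in `I`.
  obtain ⟨r, hr, hr'⟩ := Submodule.exists_sub_one_mem_and_smul_eq_zero_of_fg_of_le_smul
    (Ideal.span {a}) (⊤ : Submodule R (S ⧸ I)) Module.Finite.fg_top fun m _ => by
      obtain ⟨m, rfl⟩ := Ideal.Quotient.mk_surjective m
      have : Ideal.Quotient.mk I m = a • Ideal.Quotient.mk I (s * m) := by
        rw [hsmul, Ideal.Quotient.eq, show m - φ a * (s * m) = i * m by
          linear_combination -m * hib]
        exact I.mul_mem_right _ hi
      rw [this]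
      exact Submodule.smul_mem_smul (Ideal.mem_span_singleton_self a) trivial
  rw [Ideal.eq_top_iff_one, ← sub_sub_cancel r 1]
  refine sub_mem (Ideal.mem_sup_left ?_) (Ideal.mem_sup_right hr)
  rw [Ideal.mem_comap, ← Ideal.Quotient.eq_zero_iff_mem]
  rw [← mul_one (φ r), ← hsmul]
  exact hr' _ trivial

/-- A finite module over `A` vanishes modulo `a` if and only if its annihilator and `a` generate the
unit ideal. -/
theorem Module.subsingleton_quotient_smul_top_iff {A M : Type*} [CommRing A] [AddCommGroup M]
    [Module A M] [Module.Finite A M] (a : A) :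
    Subsingleton (M ⧸ (Ideal.span {a} • (⊤ : Submodule A M))) ↔
      Module.annihilator A M ⊔ Ideal.span {a} = ⊤ := by
  rw [Submodule.Quotient.subsingleton_iff]
  constructor
  · intro h
    obtain ⟨r, hr, hr'⟩ := Submodule.exists_sub_one_mem_and_smul_eq_zero_of_fg_of_le_smul
      (Ideal.span {a}) (⊤ : Submodule A M) Module.Finite.fg_top h.ge
    rw [Ideal.eq_top_iff_one, ← sub_sub_cancel r 1]
    exact sub_mem (Ideal.mem_sup_left (Module.mem_annihilator.2 fun m => hr' m trivial))
      (Ideal.mem_sup_right hr)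
  · intro h
    obtain ⟨r, hr, b, hb, hrb⟩ := Submodule.mem_sup.1 ((Ideal.eq_top_iff_one _).1 h)
    refine eq_top_iff.2 fun m _ => ?_
    rw [← one_smul A m, ← hrb, add_smul, Module.mem_annihilator.1 hr m, zero_add]
    exact Submodule.smul_mem_smul hb trivial

/-- If `π ∘ ι` is the identity modulo `a` and `π` kills `ι a`, then an ideal whose extension along
`ι` is the unit ideal modulo `ι a` is the unit ideal modulo `a`. -/
theorem Ideal.sup_span_eq_top_of_retraction {R S : Type*} [CommRing R] [CommRing S]
    (ι : R →+* S) (π : S →+* R) {a : R} (ha : π (ι a) = 0)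
    (h : ∀ f, f - π (ι f) ∈ Ideal.span {a}) (I : Ideal R)
    (hI : I.map ι ⊔ Ideal.span {ι a} = ⊤) : I ⊔ Ideal.span {a} = ⊤ := by
  have h1 := congrArg (Ideal.map π) hI
  rw [Ideal.map_top, Ideal.map_sup, Ideal.map_span, Set.image_singleton, ha, Ideal.map_map,
    Ideal.span_singleton_eq_bot.2 rfl, sup_bot_eq] at h1
  rw [eq_top_iff, ← h1, Ideal.map_le_iff_le_comap]
  intro f hf
  rw [Ideal.mem_comap, RingHom.comp_apply, ← sub_sub_cancel f (π (ι f))]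
  exact sub_mem (Ideal.mem_sup_left hf) (Ideal.mem_sup_right (h f))

/-- A perturbation of the identity by a strict contraction is surjective. -/
theorem surjective_sub_of_contraction {H : Type*} [NormedAddCommGroup H] [CompleteSpace H]
    (E : H →+ H) {δ : ℝ} (hδ : δ < 1) (hE : ∀ h, ‖E h‖ ≤ δ * ‖h‖) (h : H) :
    ∃ y, y - E y = h := by
  have hc : ContractingWith δ.toNNReal fun y => h + E y := by
    refine ⟨by simpa using hδ, LipschitzWith.of_dist_le_mul fun x y => ?_⟩
    rw [dist_add_left, dist_eq_norm, dist_eq_norm, ← map_sub]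
    exact (hE _).trans (mul_le_mul_of_nonneg_right (Real.le_coe_toNNReal δ) (norm_nonneg _))
  exact ⟨_, sub_eq_of_eq_add hc.fixedPoint_isFixedPt.eq.symm⟩

/-! ### Series over a disc in `z`: substitution, shrinking and translation. -/

namespace restrictedSeries

/-- The polyradius `(1, …, 1, ρ)`. -/
noncomputable def radius (d : ℕ) (ρ : {r : ℝ // 0 < r}) : Fin (d + 1) → {r : ℝ // 0 < r} :=
  Fin.snoc (α := fun _ => {r : ℝ // 0 < r}) (fun _ => ⟨1, one_pos⟩) ρ

@[simp] lemma radius_castSucc (d : ℕ) (ρ : {r : ℝ // 0 < r}) (i : Fin d) :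
    radius d ρ i.castSucc = ⟨1, one_pos⟩ := Fin.snoc_castSucc ..

@[simp] lemma radius_last (d : ℕ) (ρ : {r : ℝ // 0 < r}) : radius d ρ (Fin.last d) = ρ :=
  Fin.snoc_last ..

lemma weight_radius {d : ℕ} {ρ : {r : ℝ // 0 < r}} (t : Fin (d + 1) →₀ ℕ) :
    weight (radius d ρ) t = (ρ : ℝ) ^ t (Fin.last d) := by
  rw [weight, Finsupp.prod_fintype _ _ fun _ => pow_zero _, Fin.prod_univ_castSucc]
  simp

variable {K : Type*} [NormedField K] [IsUltrametricDist K]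

section

variable {σ : Type*} {c : σ → {r : ℝ // 0 < r}}

lemma continuous_coeff (t : σ →₀ ℕ) :
    Continuous (coeff t : restrictedSeries K c → K) := by
  let φ : restrictedSeries K c →+ K := ⟨⟨coeff t, rfl⟩, fun _ _ => rfl⟩
  refine AddMonoidHomClass.continuous_of_bound φ (weight c t)⁻¹ fun f => ?_
  rw [inv_mul_eq_div, le_div_iff₀ (weight_pos t)]
  exact norm_coeff_mul_le t f

end

variable (K) in
/-- The restricted power series in `x_1, …, x_d` (of radius `1`) and `z` (of radius `ρ`). -/
abbrev DiscSeries (d : ℕ) (ρ : {r : ℝ // 0 < r}) : Type _ := restrictedSeries K (radius d ρ)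

/-- `I` and `z - c` generate the unit ideal. -/
def VanishesAt {d : ℕ} {ρ : {r : ℝ // 0 < r}} (I : Ideal (DiscSeries K d ρ)) (c : K) : Prop :=
  I ⊔ Ideal.span {X (Fin.last d) - algebraMap K (DiscSeries K d ρ) c} = ⊤

variable {d : ℕ} {ρ ρ' : {r : ℝ // 0 < r}}

lemma monomial_one_eq (t : Fin (d + 1) →₀ ℕ) :
    (monomial t 1 : DiscSeries K d ρ) =
      (∏ i : Fin d, X i.castSucc ^ t i.castSucc) * X (Fin.last d) ^ t (Fin.last d) := by
  rw [monomial_eq_prod, Finsupp.prod_fintype _ _ fun _ => pow_zero _, Fin.prod_univ_castSucc]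

lemma norm_algebraMap_le {c : K} (hc : ‖c‖ ≤ ρ) : ‖algebraMap K (DiscSeries K d ρ') c‖ ≤ ρ := by
  rwa [norm_algebraMap']

/-- The condition on `φ` makes it carry `z - c` to `z - c'`, so a relation expressing `1` is carried
along. -/
lemma VanishesAt.map {I : Ideal (DiscSeries K d ρ)} {c : K} (h : VanishesAt I c)
    {d' : ℕ} (φ : DiscSeries K d ρ →ₐ[K] DiscSeries K d' ρ') {c' : K}
    (hφ : φ (X (Fin.last d)) = X (Fin.last d') + algebraMap K _ (c - c'))
    {J : Ideal (DiscSeries K d' ρ')} (hJ : I.map φ ≤ J) :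
    VanishesAt J c' := by
  have h1 := congrArg (Ideal.map φ) h
  rw [Ideal.map_top, Ideal.map_sup, Ideal.map_span, Set.image_singleton, map_sub, hφ,
    AlgHom.commutes, map_sub, show X (Fin.last d') + (algebraMap K (DiscSeries K d' ρ') c -
      algebraMap K (DiscSeries K d' ρ') c') - algebraMap K (DiscSeries K d' ρ') c =
      X (Fin.last d') - algebraMap K (DiscSeries K d' ρ') c' by ring] at h1
  exact eq_top_iff.2 (h1.ge.trans (sup_le_sup_right hJ _))

variable [CompleteSpace K]

/-- The substitution `z ↦ b` fixing the other variables. -/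
noncomputable def substLast (b : DiscSeries K d ρ') (hb : ‖b‖ ≤ ρ) :
    DiscSeries K d ρ →ₐ[K] DiscSeries K d ρ' :=
  eval (Fin.snoc (α := fun _ => DiscSeries K d ρ') (fun i => X i.castSucc) b) fun i => by
    induction i using Fin.lastCases with
    | last => simpa using hb
    | cast i => simp [norm_X]

@[simp] lemma substLast_X_castSucc (b : DiscSeries K d ρ') (hb : ‖b‖ ≤ ρ) (i : Fin d) :
    substLast b hb (X i.castSucc) = X i.castSucc := by simp [substLast]

@[simp] lemma substLast_X_last (b : DiscSeries K d ρ') (hb : ‖b‖ ≤ ρ) :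
    substLast b hb (X (Fin.last d)) = b := by simp [substLast]

lemma norm_substLast_le (b : DiscSeries K d ρ') (hb : ‖b‖ ≤ ρ) (f : DiscSeries K d ρ) :
    ‖substLast b hb f‖ ≤ ‖f‖ := norm_eval_le _ _ f

lemma continuous_substLast (b : DiscSeries K d ρ') (hb : ‖b‖ ≤ ρ) :
    Continuous (substLast b hb) := continuous_eval _ _

lemma substLast_substLast {ρ'' : {r : ℝ // 0 < r}} (b : DiscSeries K d ρ') (hb : ‖b‖ ≤ ρ)
    (b' : DiscSeries K d ρ'') (hb' : ‖b'‖ ≤ ρ') (f : DiscSeries K d ρ) :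
    substLast b' hb' (substLast b hb f) =
      substLast (substLast b' hb' b) ((norm_substLast_le b' hb' b).trans hb) f := by
  refine DFunLike.congr_fun (algHom_ext (φ := (substLast b' hb').comp (substLast b hb))
    ((continuous_substLast b' hb').comp (continuous_substLast b hb))
    (continuous_substLast _ _) fun i => ?_) f
  induction i using Fin.lastCases with
  | last => simp
  | cast i => simp

lemma substLast_X_last_self (f : DiscSeries K d ρ) :
    substLast (X (Fin.last d)) (by simp [norm_X]) f = f := by
  refine DFunLike.congr_fun (algHom_ext (ψ := AlgHom.id K _)
    (continuous_substLast _ _) continuous_id fun i => ?_) f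
  induction i using Fin.lastCases with
  | last => simp
  | cast i => simp

lemma coeff_substLast_X_last (h : ‖(X (Fin.last d) : DiscSeries K d ρ')‖ ≤ ρ)
    (f : DiscSeries K d ρ) (t : Fin (d + 1) →₀ ℕ) :
    coeff t (substLast (X (Fin.last d)) h f) = coeff t f := by
  let φ : DiscSeries K d ρ →+ K := AddMonoidHom.mk'
    (fun f => coeff t (substLast (X (Fin.last d)) h f)) fun f g => by rw [map_add, coeff_add]
  let ψ : DiscSeries K d ρ →+ K := AddMonoidHom.mk' (fun f => coeff t f) fun f g => coeff_add t f g
  have hφ : Continuous φ := (continuous_coeff t).comp (continuous_substLast _ h)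
  have hψ : Continuous ψ := continuous_coeff t
  suffices hφψ : ∀ s a, φ (monomial s a) = ψ (monomial s a) from
    DFunLike.congr_fun (addMonoidHom_ext hφ hψ hφψ) f
  intro s a
  have : substLast (X (Fin.last d)) h (monomial s a : DiscSeries K d ρ) = monomial s a := by
    rw [monomial_eq_smul, monomial_one_eq, monomial_eq_smul, monomial_one_eq]
    simp
  change coeff t (substLast (X (Fin.last d)) h (monomial s a)) =
    coeff t (monomial s a : DiscSeries K d ρ)
  classical
  rw [this, coeff_monomial, coeff_monomial]

/-- Subtracting the value at `z = c` gives a multiple of `z - c`. -/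
lemma sub_substLast_mem {c : K} (hc : ‖c‖ ≤ ρ) (f : DiscSeries K d ρ) :
    f - substLast (algebraMap K (DiscSeries K d ρ) c) (norm_algebraMap_le hc) f ∈
      Ideal.span {X (Fin.last d) - algebraMap K (DiscSeries K d ρ) c} := by
  set P := substLast (algebraMap K (DiscSeries K d ρ) c) (norm_algebraMap_le hc)
  set z : DiscSeries K d ρ := X (Fin.last d)
  set a := algebraMap K (DiscSeries K d ρ) c
  have hρ : (0 : ℝ) < ρ := ρ.2
  let u (t : Fin (d + 1) →₀ ℕ) : DiscSeries K d ρ := ∏ i : Fin d, X i.castSucc ^ t i.castSucc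
  -- The quotient of `x ^ t - P (x ^ t)` by `z - a`, as a geometric sum. It has one power of `z` or
  -- `a` fewer, whence the constant `ρ⁻¹` in the bound.
  let q (t : Fin (d + 1) →₀ ℕ) : DiscSeries K d ρ :=
    u t * ∑ j ∈ Finset.range (t (Fin.last d)), z ^ j * a ^ (t (Fin.last d) - 1 - j)
  have hu (t) : ‖u t‖ ≤ 1 := by
    refine (Finset.norm_prod_le _ _).trans (Finset.prod_le_one (fun _ _ => norm_nonneg _)
      fun i _ => (norm_pow_le _ _).trans (pow_le_one₀ (norm_nonneg _) (by simp [norm_X])))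
  have hq (t) : ‖q t‖ ≤ (ρ : ℝ)⁻¹ * weight (radius d ρ) t := by
    refine (norm_mul_le _ _).trans
      ((mul_le_of_le_one_left (norm_nonneg _) (hu t)).trans ?_)
    refine IsUltrametricDist.norm_sum_le_of_forall_le_of_nonneg
      (mul_nonneg (inv_nonneg.2 hρ.le) (weight_nonneg t)) fun j hj => ?_
    have hj' := Finset.mem_range.1 hj
    obtain ⟨k, hk⟩ : ∃ k, t (Fin.last d) = k + 1 := ⟨t (Fin.last d) - 1, by omega⟩
    rw [weight_radius, hk, pow_succ', inv_mul_cancel_left₀ hρ.ne', Nat.add_sub_cancel]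
    calc ‖z ^ j * a ^ (k - j)‖ ≤ (ρ : ℝ) ^ j * (ρ : ℝ) ^ (k - j) :=
          (norm_mul_le _ _).trans (mul_le_mul
            ((norm_pow_le _ _).trans (pow_le_pow_left₀ (norm_nonneg _) (by simp [z, norm_X]) _))
            ((norm_pow_le _ _).trans
              (pow_le_pow_left₀ (norm_nonneg _) (norm_algebraMap_le hc) _))
            (norm_nonneg _) (pow_nonneg hρ.le _))
      _ = (ρ : ℝ) ^ k := by rw [← pow_add]; congr 1; omega
  have hcont : Continuous fun x : DiscSeries K d ρ => x - P x :=
    Continuous.sub continuous_id (continuous_substLast _ (norm_algebraMap_le hc))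
  refine Ideal.mem_span_singleton.2 ⟨lift q hq f, ?_⟩
  let φ : DiscSeries K d ρ →+ DiscSeries K d ρ :=
    AddMonoidHom.mk' (fun x => x - P x) fun x y => by rw [map_add]; ring
  let ψ : DiscSeries K d ρ →+ DiscSeries K d ρ :=
    AddMonoidHom.mk' (fun x => (z - a) * lift q hq x) fun x y => by rw [map_add]; ring
  have hψ : Continuous ψ := (continuous_const_mul (z - a)).comp (continuous_lift q hq)
  suffices hφψ : ∀ t b, φ (monomial t b) = ψ (monomial t b) from
    DFunLike.congr_fun (addMonoidHom_ext hcont hψ hφψ) f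
  intro t b
  change monomial t b - P (monomial t b) = (z - a) * lift q hq (monomial t b)
  rw [lift_monomial, monomial_eq_smul, map_smul, ← smul_sub, mul_smul_comm]
  congr 1
  have hP : P (monomial t 1) = u t * a ^ t (Fin.last d) := by
    rw [monomial_one_eq, map_mul, map_prod, map_pow, substLast_X_last]
    simp [u, P, a]
  rw [hP, monomial_one_eq]
  linear_combination -u t * (Commute.all z a).mul_geom_sum₂ (t (Fin.last d))

/-- Evaluation at `z = c` kills `z - c` and has a nonzero target. -/
lemma not_vanishesAt_bot {c : K} (hc : ‖c‖ ≤ ρ) :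
    ¬ VanishesAt (⊥ : Ideal (DiscSeries K d ρ)) c := by
  intro h
  rw [VanishesAt, bot_sup_eq] at h
  have h1 := congrArg (Ideal.map
    (substLast (algebraMap K (DiscSeries K d ρ) c) (norm_algebraMap_le hc))) h
  rw [Ideal.map_top, Ideal.map_span, Set.image_singleton, map_sub, substLast_X_last,
    AlgHom.commutes, sub_self, Ideal.span_singleton_eq_bot.2 rfl] at h1
  exact bot_ne_top h1

/-- Shrinking the disc does not change the vanishing at its points. -/
lemma vanishesAt_map_substLast_iff (h : ‖(X (Fin.last d) : DiscSeries K d ρ')‖ ≤ ρ)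
    (I : Ideal (DiscSeries K d ρ)) {c : K} (hc : ‖c‖ ≤ ρ') :
    VanishesAt (I.map (substLast (X (Fin.last d)) h)) c ↔ VanishesAt I c := by
  have hc' : ‖c‖ ≤ ρ := hc.trans (by simpa [norm_X] using h)
  refine ⟨fun hI => ?_, fun hI => hI.map (substLast (X (Fin.last d)) h) (by simp) le_rfl⟩
  refine Ideal.sup_span_eq_top_of_retraction
    (substLast (X (Fin.last d)) h : DiscSeries K d ρ →+* DiscSeries K d ρ')
    (substLast (algebraMap K (DiscSeries K d ρ) c) (norm_algebraMap_le hc) :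
      DiscSeries K d ρ' →+* DiscSeries K d ρ) (by simp) (fun f => ?_) I
      (by rw [Ideal.map_coe]; simpa [VanishesAt] using hI)
  have := sub_substLast_mem hc' f
  convert! this using 2
  refine (substLast_substLast (X (Fin.last d)) h _ (norm_algebraMap_le hc) f).trans ?_
  congr 1
  simp

/-- Translating the disc. -/
lemma vanishesAt_map_translate_iff (I : Ideal (DiscSeries K d ρ)) {a : K}
    (ha : ‖X (Fin.last d) + algebraMap K (DiscSeries K d ρ) a‖ ≤ ρ) (c : K) :
    VanishesAt (I.map (substLast (X (Fin.last d) + algebraMap K (DiscSeries K d ρ) a) ha)) c ↔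
      VanishesAt I (c + a) := by
  have hX : ‖(X (Fin.last d) : DiscSeries K d ρ)‖ = ρ := by simp [norm_X]
  have ha1 : ‖algebraMap K (DiscSeries K d ρ) a‖ ≤ ρ := by
    have := IsUltrametricDist.norm_add_le_max
      (X (Fin.last d) + algebraMap K (DiscSeries K d ρ) a) (-X (Fin.last d))
    rw [add_neg_cancel_comm, norm_neg] at this
    exact this.trans (max_le ha hX.le)
  have ha' : ‖X (Fin.last d) - algebraMap K (DiscSeries K d ρ) a‖ ≤ ρ :=
    by
    rw [sub_eq_add_neg]
    exact (IsUltrametricDist.norm_add_le_max _ _).trans (max_le hX.le (by rwa [norm_neg]))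
  refine ⟨fun h => h.map (substLast _ ha') (by simp [sub_eq_add_neg]) ?_,
    fun h => h.map _ (by simp) le_rfl⟩
  -- The opposite translation is inverse to the first, so it carries the extended ideal back into
  -- `I`.
  refine Ideal.map_le_iff_le_comap.2 (Ideal.map_le_iff_le_comap.2 fun f hf => ?_)
  rw [Ideal.mem_comap, Ideal.mem_comap]
  convert! hf
  refine (substLast_substLast _ _ _ _ f).trans ?_
  conv_rhs => rw [← substLast_X_last_self f]
  congr 1
  simp

end restrictedSeries

/-! ### Nagata's change of variables and polynomial division. -/

namespace MvPolynomial

/-- Nagata's change of variables `x_i ↦ x_i + a x_0 ^ (N ^ i)` for `i ≠ 0`. -/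
noncomputable def nagataHom {R : Type*} [CommRing R] {n : ℕ} (N : ℕ) (a : R) :
    MvPolynomial (Fin (n + 1)) R →ₐ[R] MvPolynomial (Fin (n + 1)) R :=
  aeval fun i => if i = 0 then X 0 else X i + a • X 0 ^ N ^ i.1

lemma nagataHom_comp {R : Type*} [CommRing R] {n : ℕ} (N : ℕ) (a : R) :
    (nagataHom (n := n) N a).comp (nagataHom N (-a)) = AlgHom.id _ _ := by
  ext i : 1
  cases i using Fin.cases <;> simp [nagataHom]

/-- Nagata's change of variables as an automorphism. -/
noncomputable def nagataEquiv (R : Type*) [CommRing R] (n N : ℕ) :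
    MvPolynomial (Fin (n + 1)) R ≃ₐ[R] MvPolynomial (Fin (n + 1)) R :=
  AlgEquiv.ofAlgHom (nagataHom N 1) (nagataHom N (-1)) (nagataHom_comp N 1)
    (by simpa using nagataHom_comp (R := R) (n := n) N (-1))

variable {R : Type*} [CommRing R] {n : ℕ} {N : ℕ}

lemma finSuccEquiv_nagataEquiv_X (i : Fin (n + 1)) :
    finSuccEquiv R n (nagataEquiv R n N (X i)) =
      if h : i = 0 then Polynomial.X
      else Polynomial.X ^ N ^ i.1 + Polynomial.C (X (i.pred h)) := by
  cases i using Fin.cases with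
  | zero => simp [nagataEquiv, nagataHom, finSuccEquiv_X_zero]
  | succ i =>
    simp [nagataEquiv, nagataHom, finSuccEquiv_X_zero, finSuccEquiv_X_succ, add_comm]

lemma monic_finSuccEquiv_nagataEquiv_X [IsDomain R] (hN : N ≠ 0) (i : Fin (n + 1)) :
    (finSuccEquiv R n (nagataEquiv R n N (X i))).Monic ∧
      (finSuccEquiv R n (nagataEquiv R n N (X i))).natDegree = N ^ i.1 := by
  rw [finSuccEquiv_nagataEquiv_X]
  split_ifs with h
  · subst h; simp [Polynomial.monic_X]
  · exact ⟨Polynomial.monic_X_pow_add_C _ (pow_ne_zero _ hN), Polynomial.natDegree_X_pow_add_C⟩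

lemma finSuccEquiv_nagataEquiv_monomial [IsDomain R] (hN : N ≠ 0) (v : Fin (n + 1) →₀ ℕ) :
    ∃ P : Polynomial (MvPolynomial (Fin n) R), P.Monic ∧
      P.natDegree = ∑ i : Fin (n + 1), N ^ i.1 * v i ∧
      ∀ a, finSuccEquiv R n (nagataEquiv R n N (monomial v a)) = Polynomial.C (C a) * P := by
  have hm (i : Fin (n + 1)) := monic_finSuccEquiv_nagataEquiv_X (R := R) hN i
  refine ⟨∏ i : Fin (n + 1), finSuccEquiv R n (nagataEquiv R n N (X i)) ^ v i,
    Polynomial.monic_prod_of_monic _ _ fun i _ => (hm i).1.pow _, ?_, fun a => ?_⟩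
  · rw [Polynomial.natDegree_prod_of_monic _ _ fun i _ => (hm i).1.pow _]
    exact Finset.sum_congr rfl fun i _ => by rw [(hm i).1.natDegree_pow, (hm i).2, mul_comm]
  · rw [monomial_eq, Finsupp.prod_fintype _ _ fun _ => pow_zero _, map_mul, map_mul, map_prod,
      map_prod]
    simp only [map_pow]
    rw [← algebraMap_eq, AlgEquiv.commutes, AlgEquiv.commutes]
    rfl

/-- The exponents are the base-`N` digits of the sum. Hence distinct monomials acquire distinct
degrees, and leading terms cannot cancel. -/
lemma sum_pow_mul_injective {v w : Fin (n + 1) →₀ ℕ} (hN : 1 < N) (hv : ∀ i, v i < N)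
    (hw : ∀ i, w i < N) (h : ∑ i : Fin (n + 1), N ^ i.1 * v i = ∑ i : Fin (n + 1), N ^ i.1 * w i) :
    v = w := by
  refine Finsupp.ext <| congrFun <| List.ofFn_inj.mp ?_
  refine Nat.ofDigits_inj_of_len_eq hN (by simp) (by grind)
    (by grind) ?_
  simpa only [Nat.ofDigits_eq_sum_mapIdx, List.mapIdx_eq_ofFn, List.get_ofFn, List.length_ofFn,
    Fin.val_cast, mul_comm, List.sum_ofFn] using! h

variable [IsDomain R]

/-- Nagata's change of variables makes a polynomial with unit coefficients have a unit leading
coefficient in the distinguished variable. -/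
lemma exists_isUnit_leadingCoeff_nagataEquiv {f : MvPolynomial (Fin (n + 1)) R} (hf : f ≠ 0)
    (hu : ∀ v ∈ f.support, IsUnit (coeff v f)) :
    ∃ N, IsUnit (finSuccEquiv R n (nagataEquiv R n N f)).leadingCoeff := by
  -- Larger than every exponent of `f`, and at least `2` so that it is a base even when `f` is
  -- constant.
  let N := 2 + f.totalDegree
  have hN : N ≠ 0 := by simp [N]
  refine ⟨N, ?_⟩
  choose P hPm hPd hP using fun v => finSuccEquiv_nagataEquiv_monomial (R := R) (n := n) hN v
  obtain ⟨v, hv, hmax⟩ := Finset.exists_max_image f.support (fun v => (P v).natDegree)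
    (support_nonempty.mpr hf)
  have hlt (w) (hw : w ∈ f.support) (i) : w i < N :=
    ((monomial_le_degreeOf i hw).trans (degreeOf_le_totalDegree f i)).trans_lt (by simp [N])
  have hcoef (w) (hw : w ∈ f.support) : C (coeff w f) ≠ (0 : MvPolynomial (Fin n) R) := by
    simpa using hw
  have hdeg (w) (hw : w ∈ f.support) :
      (Polynomial.C (C (coeff w f)) * P w).degree = (P w).degree := by
    rw [Polynomial.degree_mul, Polynomial.degree_C (hcoef w hw), zero_add]
  have hsum : finSuccEquiv R n (nagataEquiv R n N f) =
      ∑ w ∈ f.support \ {v}, Polynomial.C (C (coeff w f)) * P w +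
        Polynomial.C (C (coeff v f)) * P v := by
    rw [Finset.sum_sdiff_eq_sub (by simpa using hv), Finset.sum_singleton, sub_add_cancel]
    conv_lhs => rw [← f.support_sum_monomial_coeff]
    rw [map_sum, map_sum]
    exact Finset.sum_congr rfl fun w _ => hP w _
  rw [hsum, Polynomial.leadingCoeff_add_of_degree_lt, Polynomial.leadingCoeff_mul,
    Polynomial.leadingCoeff_C, (hPm v).leadingCoeff, mul_one]
  · exact (hu v hv).map C
  · refine (Polynomial.degree_sum_le _ _).trans_lt ?_
    rw [hdeg v hv, Finset.sup_lt_iff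
      (Ne.bot_lt fun h => (hPm v).ne_zero (Polynomial.degree_eq_bot.1 h))]
    intro w hw
    obtain ⟨hw, hwv⟩ := Finset.mem_sdiff.1 hw
    rw [hdeg w hw]
    refine Polynomial.degree_lt_degree (lt_of_le_of_ne (hmax w hw) fun h => hwv ?_)
    rw [hPd, hPd] at h
    simpa using sum_pow_mul_injective (by omega) (hlt w hw) (hlt v hv) h

/-- Division with remainder by a nonzero polynomial with unit coefficients, with respect to suitable
new variables `y`. -/
theorem exists_forall_eq_sum_aeval_mul_add {f : MvPolynomial (Fin (n + 1)) R} (hf : f ≠ 0)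
    (hu : ∀ v ∈ f.support, IsUnit (coeff v f)) :
    ∃ (s : ℕ) (y : Fin n → MvPolynomial (Fin (n + 1)) R), ∀ p,
      ∃ (b : Fin s → MvPolynomial (Fin n) R)
      (q : MvPolynomial (Fin (n + 1)) R), p = ∑ j, aeval y (b j) * X 0 ^ j.1 + q * f := by
  obtain ⟨N, hN⟩ := exists_isUnit_leadingCoeff_nagataEquiv hf hu
  set T := nagataEquiv R n N
  set F := finSuccEquiv R n (T f)
  let Φ : Polynomial (MvPolynomial (Fin n) R) ≃ₐ[R] MvPolynomial (Fin (n + 1)) R :=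
    (finSuccEquiv R n).symm.trans T.symm
  have hX : Φ Polynomial.X = X 0 := by
    rw [show (Polynomial.X : Polynomial (MvPolynomial (Fin n) R)) = finSuccEquiv R n (T (X 0)) by
      simp [T, finSuccEquiv_nagataEquiv_X]]
    simp [Φ]
  have hC (b : MvPolynomial (Fin n) R) :
      Φ (Polynomial.C b) = aeval (fun i => Φ (Polynomial.C (X i))) b := by
    induction b using MvPolynomial.induction_on with
    | C a =>
      rw [← algebraMap_eq, AlgHom.commutes]
      exact Φ.commutes a
    | add p q hp hq => rw [map_add, map_add, map_add, hp, hq]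
    | mul_X p i hp => rw [map_mul, map_mul, map_mul, hp, aeval_X]
  obtain ⟨u, hu'⟩ := hN
  -- Scaling by the inverse leading coefficient gives a monic divisor; the quotient reabsorbs the
  -- unit.
  let G := F * Polynomial.C ((u⁻¹ : (MvPolynomial (Fin n) R)ˣ) : MvPolynomial (Fin n) R)
  have hG : G.Monic := by
    refine Polynomial.monic_mul_C_of_leadingCoeff_mul_eq_one ?_
    rw [← hu', Units.mul_inv]
  have hF : Φ F = f := by simp [Φ, F]
  -- One slot more than the degree, so that the bound on the remainder also covers a divisor of
  -- degree `0`.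
  refine ⟨G.natDegree + 1, fun i => Φ (Polynomial.C (X i)), fun p => ?_⟩
  set P := finSuccEquiv R n (T p)
  have hp : Φ P = p := by simp [Φ, P]
  refine ⟨fun j => (P %ₘ G).coeff j,
    Φ (Polynomial.C ((u⁻¹ : (MvPolynomial (Fin n) R)ˣ) : MvPolynomial (Fin n) R) * (P /ₘ G)), ?_⟩
  have hlt := Nat.lt_succ_of_le (Polynomial.natDegree_modByMonic_le P hG)
  conv_lhs => rw [← hp, ← Polynomial.modByMonic_add_div P G, map_add]
  congr 1
  · conv_lhs => rw [Polynomial.as_sum_range_C_mul_X_pow' (P %ₘ G) hlt]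
    rw [map_sum, Finset.sum_range]
    exact Finset.sum_congr rfl fun j _ => by rw [map_mul, map_pow, hX, hC]
  · set Q := Polynomial.C ((u⁻¹ : (MvPolynomial (Fin n) R)ˣ) : MvPolynomial (Fin n) R) * (P /ₘ G)
    have hQ : G * (P /ₘ G) = Q * F := by simp only [G, Q]; ring
    rw [hQ, map_mul, hF]

end MvPolynomial

/-! ### Integral polynomials and normalisation of a series at `z = 0`. -/

namespace restrictedSeries

variable {K : Type*} [NormedField K] [IsUltrametricDist K] {d : ℕ} {ρ ρ' : {r : ℝ // 0 < r}}

variable (K) in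
/-- The valuation ring of `K`. -/
def unitBall : Subring K where
  carrier := {x | ‖x‖ ≤ 1}
  mul_mem' hx hy := (norm_mul_le _ _).trans (mul_le_one₀ hx (norm_nonneg _) hy)
  one_mem' := norm_one.le
  add_mem' hx hy := (IsUltrametricDist.norm_add_le_max _ _).trans (max_le hx hy)
  zero_mem' := by simp
  neg_mem' hx := by simpa using hx

lemma isUnit_unitBall {a : unitBall K} (ha : ‖(a : K)‖ = 1) : IsUnit a := by
  have ha' : (a : K) ≠ 0 := fun h => by simp [h] at ha
  refine .of_mul_eq_one ⟨(a : K)⁻¹, by simp [unitBall, ha]⟩ (Subtype.ext ?_)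
  simp [ha']

/-- Polynomials in `x_1, …, x_d` with integral coefficients, as restricted power series. -/
noncomputable def ofPoly (ρ : {r : ℝ // 0 < r}) :
    MvPolynomial (Fin d) (unitBall K) →+* DiscSeries K d ρ :=
  MvPolynomial.eval₂Hom ((algebraMap K _).comp (unitBall K).subtype) fun i => X i.castSucc

@[simp] lemma ofPoly_X (i : Fin d) :
    ofPoly (K := K) ρ (MvPolynomial.X i) = X i.castSucc := by simp [ofPoly]

@[simp] lemma ofPoly_C (a : unitBall K) :
    ofPoly (d := d) ρ (MvPolynomial.C a) = algebraMap K _ (a : K) := by simp [ofPoly]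

lemma norm_ofPoly_le (p : MvPolynomial (Fin d) (unitBall K)) : ‖ofPoly ρ p‖ ≤ 1 := by
  induction p using MvPolynomial.induction_on with
  | C a => rw [ofPoly_C, norm_algebraMap']; exact a.2
  | add p q hp hq =>
    rw [map_add]; exact (IsUltrametricDist.norm_add_le_max _ _).trans (max_le hp hq)
  | mul_X p i hp =>
    rw [map_mul]
    exact (norm_mul_le _ _).trans (mul_le_one₀ hp (norm_nonneg _) (by simp [norm_X]))

/-- Extension of a multi-index by zero in the last variable. -/
noncomputable def snocZero (v : Fin d →₀ ℕ) : Fin (d + 1) →₀ ℕ :=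
  Finsupp.equivFunOnFinite.symm (Fin.snoc (α := fun _ => ℕ) v 0)

@[simp] lemma snocZero_castSucc (v : Fin d →₀ ℕ) (i : Fin d) : snocZero v i.castSucc = v i := by
  simp [snocZero]

@[simp] lemma snocZero_last (v : Fin d →₀ ℕ) : snocZero v (Fin.last d) = 0 := by simp [snocZero]

lemma snocZero_injective : Function.Injective (snocZero (d := d)) := fun v w h => by
  ext i
  simpa using DFunLike.congr_fun h i.castSucc

lemma exists_snocZero_eq {t : Fin (d + 1) →₀ ℕ} (ht : t (Fin.last d) = 0) :
    ∃ v, snocZero v = t := by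
  refine ⟨Finsupp.equivFunOnFinite.symm fun i => t i.castSucc, Finsupp.ext fun i => ?_⟩
  induction i using Fin.lastCases with
  | last => simp [ht]
  | cast i => simp

lemma ofPoly_monomial (v : Fin d →₀ ℕ) (a : unitBall K) :
    ofPoly ρ (MvPolynomial.monomial v a) = monomial (snocZero v) (a : K) := by
  rw [monomial_eq_smul, monomial_one_eq, Algebra.smul_def, ofPoly, MvPolynomial.coe_eval₂Hom,
    MvPolynomial.eval₂_monomial, Finsupp.prod_fintype _ _ fun _ => pow_zero _]
  simp

lemma monomial_one_eq_ofPoly_mul (t : Fin (d + 1) →₀ ℕ) :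
    (monomial t 1 : DiscSeries K d ρ) =
      ofPoly ρ (∏ i : Fin d, MvPolynomial.X i ^ t i.castSucc) *
        X (Fin.last d) ^ t (Fin.last d) := by
  rw [monomial_one_eq]
  simp

/-- Division by a power of `z`. -/
lemma exists_X_last_pow_mul {f : DiscSeries K d ρ} (hf : f ≠ 0) :
    ∃ (m : ℕ) (g : DiscSeries K d ρ), X (Fin.last d) ^ m * g = f ∧
      ∃ t, t (Fin.last d) = 0 ∧ coeff t g ≠ 0 := by
  classical
  have hex : ∃ n, ∃ t : Fin (d + 1) →₀ ℕ, t (Fin.last d) = n ∧ coeff t f ≠ 0 := by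
    by_contra! h
    exact hf (ext fun t => h _ t rfl)
  -- The least `z`-exponent occurring in `f`: all of `f` is divisible by `z ^ m`, and the quotient
  -- has a term free of `z`.
  set m := Nat.find hex
  set e : Fin (d + 1) →₀ ℕ := Finsupp.single (Fin.last d) m
  have hg : Tendsto (fun t => ‖coeff (t + e) f‖ * weight (radius d ρ) t) cofinite (𝓝 0) := by
    have h := ((tendsto_coeff f).comp (add_left_injective e).tendsto_cofinite).mul_const
      (weight (radius d ρ) e)⁻¹
    rw [zero_mul] at h
    refine h.congr fun t => ?_
    rw [Function.comp_apply, weight_add, ← mul_assoc, mul_assoc,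
      mul_inv_cancel₀ (weight_pos e).ne', mul_one]
  have hmul : X (Fin.last d) ^ m * mk (fun t => coeff (t + e) f) hg = f := by
    refine ext fun t => ?_
    rw [X_pow]
    refine (MvPowerSeries.coeff_monomial_mul _ _ _ _).trans ?_
    split_ifs with h
    · rw [one_mul]
      change coeff (t - e + e) f = coeff t f
      rw [tsub_add_cancel_of_le h]
    · by_contra h'
      refine h ((Finsupp.single_le_iff ..).2 ?_)
      exact Nat.find_min' hex ⟨t, rfl, Ne.symm h'⟩
  obtain ⟨t, ht, ht'⟩ := Nat.find_spec hex
  have hte : e ≤ t := (Finsupp.single_le_iff ..).2 ht.ge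
  refine ⟨m, _, hmul, t - e, by simp [e, ht, m], ?_⟩
  rwa [coeff_mk, tsub_add_cancel_of_le hte]

/-- A nonzero ideal contains a power of `z` times an element whose restriction to `z = 0` has Gauss
norm one. -/
lemma exists_normalized_mem {I : Ideal (DiscSeries K d ρ)} (hI : I ≠ ⊥) :
    ∃ (m : ℕ) (g : DiscSeries K d ρ), X (Fin.last d) ^ m * g ∈ I ∧
      (∀ t, t (Fin.last d) = 0 → ‖coeff t g‖ ≤ 1) ∧ ∃ t, t (Fin.last d) = 0 ∧ ‖coeff t g‖ = 1 := by
  classical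
  obtain ⟨f, hfI, hf⟩ := Submodule.exists_mem_ne_zero_of_ne_bot hI
  obtain ⟨m, g, rfl, t₁, ht₁, hgt₁⟩ := exists_X_last_pow_mul hf
  have hfin : {t | ¬ ‖coeff t g‖ * weight (radius d ρ) t < ‖coeff t₁ g‖}.Finite :=
    (tendsto_coeff g).eventually_lt_const (norm_pos_iff.2 hgt₁)
  -- On the slice `z = 0` the weight is `1`, and only finitely many coefficients there are at least
  -- as large as the one at `t₁`; so a largest one exists.
  obtain ⟨t₀, ht₀, hmax⟩ := (hfin.toFinset.filter fun t => t (Fin.last d) = 0).exists_max_image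
    (fun t => ‖coeff t g‖) ⟨t₁, by simp [weight_radius, ht₁]⟩
  rw [Finset.mem_filter] at ht₀
  have hmax' (t : Fin (d + 1) →₀ ℕ) (ht : t (Fin.last d) = 0) : ‖coeff t g‖ ≤ ‖coeff t₀ g‖ := by
    by_cases h : ‖coeff t g‖ < ‖coeff t₁ g‖
    · exact h.le.trans (hmax _ (by simp [weight_radius, ht₁]))
    · exact hmax _ (by simpa [weight_radius, ht] using h)
  have h0 : coeff t₀ g ≠ 0 := norm_pos_iff.1 ((norm_pos_iff.2 hgt₁).trans_le (hmax' t₁ ht₁))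
  refine ⟨m, (coeff t₀ g)⁻¹ • g, ?_, fun t ht => ?_, t₀, ht₀.2, ?_⟩
  · rw [mul_smul_comm, Algebra.smul_def]
    exact I.mul_mem_left _ hfI
  · rw [coeff_smul, norm_mul, norm_inv, inv_mul_le_iff₀ (norm_pos_iff.2 h0), mul_one]
    exact hmax' t ht
  · rw [coeff_smul, inv_mul_cancel₀ h0, norm_one]

/-- After shrinking the disc in `z`, a normalised series is close to a polynomial in the other
variables all of whose nonzero coefficients are units. -/
lemma exists_poly_close [CompleteSpace K] {g : DiscSeries K d ρ}
    (hg : ∀ t, t (Fin.last d) = 0 → ‖coeff t g‖ ≤ 1)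
    (hg' : ∃ t, t (Fin.last d) = 0 ∧ ‖coeff t g‖ = 1) :
    ∃ (ρ' : {r : ℝ // 0 < r}) (h : ‖(X (Fin.last d) : DiscSeries K d ρ')‖ ≤ ρ)
      (G : MvPolynomial (Fin d) (unitBall K)), G ≠ 0 ∧
      (∀ v ∈ G.support, IsUnit (MvPolynomial.coeff v G)) ∧
      ‖substLast (X (Fin.last d)) h g - ofPoly ρ' G‖ < 1 := by
  classical
  have hfin : {t | ¬ ‖coeff t g‖ * weight (radius d ρ) t < 1}.Finite :=
    (tendsto_coeff g).eventually_lt_const one_pos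
  have hSfin : {v : Fin d →₀ ℕ | ‖coeff (snocZero v) g‖ = 1}.Finite :=
    (hfin.preimage snocZero_injective.injOn).subset fun v hv => by
      have hv' : ‖coeff (snocZero v) g‖ = 1 := hv
      simp [weight_radius, hv']
  set S := hSfin.toFinset
  have hS (v) : v ∈ S ↔ ‖coeff (snocZero v) g‖ = 1 := by simp [S]
  let a (v : Fin d →₀ ℕ) : unitBall K := ⟨coeff (snocZero v) g, hg _ (snocZero_last v)⟩
  -- Only the terms of norm exactly `1` on the slice are kept, so every nonzero coefficient is a
  -- unit.
  let G : MvPolynomial (Fin d) (unitBall K) := ∑ v ∈ S, MvPolynomial.monomial v (a v)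
  have hGcoeff (v) : MvPolynomial.coeff v G = if v ∈ S then a v else 0 := by
    simp [G, MvPolynomial.coeff_sum, MvPolynomial.coeff_monomial]
  have ha {v} (hv : v ∈ S) : IsUnit (a v) := isUnit_unitBall ((hS v).1 hv)
  have hpos : 0 < ‖g‖ + 1 := by positivity
  have hρ := ρ.2
  -- A term of `z`-degree `k ≥ 1` then has size at most `‖g‖ / (‖g‖ + 1) ^ k < 1`.
  let ρ' : {r : ℝ // 0 < r} := ⟨ρ / (‖g‖ + 1), div_pos ρ.2 hpos⟩
  have hρ' : (ρ' : ℝ) ≤ ρ := div_le_self ρ.2.le (by simp)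
  refine ⟨ρ', by simpa [norm_X] using hρ', G, fun h => ?_, fun v hv => ?_, ?_⟩
  · obtain ⟨t, ht, ht'⟩ := hg'
    obtain ⟨v, rfl⟩ := exists_snocZero_eq ht
    have hv := (hS v).2 ht'
    have := hGcoeff v
    rw [h, MvPolynomial.coeff_zero, if_pos hv] at this
    exact (ha hv).ne_zero this.symm
  · rw [MvPolynomial.mem_support_iff, hGcoeff] at hv
    rw [hGcoeff]
    split_ifs at hv ⊢ with h
    · exact ha h
    · exact absurd rfl hv
  · have hκ (t) : coeff t (ofPoly ρ' G) = ∑ v ∈ S, if t = snocZero v then coeff t g else 0 := by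
      rw [map_sum, coeff_sum]
      refine Finset.sum_congr rfl fun v _ => ?_
      rw [ofPoly_monomial, coeff_monomial]
      split_ifs with h
      · rw [h]
      · rfl
    refine norm_lt one_pos fun t => ?_
    rw [coeff_sub, coeff_substLast_X_last, hκ]
    by_cases ht : t (Fin.last d) = 0
    · obtain ⟨v, rfl⟩ := exists_snocZero_eq ht
      rw [weight_radius, ht, pow_zero, mul_one]
      simp only [snocZero_injective.eq_iff, Finset.sum_ite_eq]
      split_ifs with hv
      · simp
      · rw [sub_zero]
        exact lt_of_le_of_ne (hg _ ht) fun h => hv ((hS v).2 h)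
    · rw [Finset.sum_eq_zero fun v _ => if_neg fun h => ht (by rw [h, snocZero_last]), sub_zero,
        weight_radius, div_pow, ← mul_div_assoc, div_lt_one (pow_pos hpos _), ← weight_radius]
      refine (norm_coeff_mul_le t g).trans_lt ((lt_add_one _).trans_le ?_)
      exact le_self_pow₀ (by simp) ht

/-- Adding `g` to an ideal that contains `z ^ m * g` does not change the vanishing at nonzero
points. -/
lemma vanishesAt_sup_span_iff {I : Ideal (DiscSeries K d ρ)} {m : ℕ} {g : DiscSeries K d ρ}
    (hg : X (Fin.last d) ^ m * g ∈ I) {c : K} (hc : c ≠ 0) :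
    VanishesAt (I ⊔ Ideal.span {g}) c ↔ VanishesAt I c := by
  refine ⟨fun h => ?_, fun h => eq_top_iff.2 (h.ge.trans (sup_le_sup_right le_sup_left _))⟩
  set z : DiscSeries K d ρ := X (Fin.last d)
  set a := algebraMap K (DiscSeries K d ρ) c
  have hga : g ∈ I ⊔ Ideal.span {z - a} := by
    -- Modulo `z - a` the factor `z ^ m` becomes `a ^ m`, a unit because `c ≠ 0`.
    have h1 : a ^ m * g ∈ I ⊔ Ideal.span {z - a} := by
      rw [show a ^ m * g = z ^ m * g - (z ^ m - a ^ m) * g by ring]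
      refine sub_mem (Ideal.mem_sup_left hg) (Ideal.mem_sup_right (Ideal.mul_mem_right _ _ ?_))
      exact Ideal.mem_span_singleton.2 (sub_dvd_pow_sub_pow z a m)
    have hu : IsUnit (a ^ m) := ((isUnit_iff_ne_zero.2 hc).map (algebraMap K _)).pow m
    exact (Ideal.unit_mul_mem_iff_mem _ hu).1 h1
  refine eq_top_iff.2 (h.ge.trans (sup_le (sup_le le_sup_left ?_) le_sup_right))
  rwa [Ideal.span_singleton_le_iff_mem]

variable [CompleteSpace K]

/-! ### Weierstrass division and the induction on the number of variables. -/

/-- Weierstrass division by a series close to a polynomial with unit coefficients, after a change of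
variables. -/
theorem exists_weierstrass_division {n : ℕ} {g : DiscSeries K (n + 1) ρ}
    {G : MvPolynomial (Fin (n + 1)) (unitBall K)} (hG : G ≠ 0)
    (hu : ∀ v ∈ G.support, IsUnit (MvPolynomial.coeff v G)) (hgG : ‖g - ofPoly ρ G‖ < 1) :
    ∃ (ψ : DiscSeries K n ρ →ₐ[K] DiscSeries K (n + 1) ρ) (s : ℕ),
      ψ (X (Fin.last n)) = X (Fin.last (n + 1)) ∧
      ∀ h, ∃ (b : Fin s → DiscSeries K n ρ) (q : DiscSeries K (n + 1) ρ),
        h = ∑ j, ψ (b j) * X 0 ^ j.1 + q * g := by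
  obtain ⟨s, y, hy⟩ := MvPolynomial.exists_forall_eq_sum_aeval_mul_add hG hu
  let ψ : DiscSeries K n ρ →ₐ[K] DiscSeries K (n + 1) ρ :=
    eval (Fin.snoc (α := fun _ => DiscSeries K (n + 1) ρ) (fun i => ofPoly ρ (y i))
      (X (Fin.last (n + 1)))) fun i => by
    induction i using Fin.lastCases with
    | last => simp [norm_X]
    | cast i => simpa using norm_ofPoly_le _
  have hψc : Continuous ψ := continuous_eval _ _
  have hψz : ψ (X (Fin.last n)) = X (Fin.last (n + 1)) := by simp [ψ]
  have hψ (p : MvPolynomial (Fin n) (unitBall K)) :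
      ψ (ofPoly ρ p) = ofPoly ρ (MvPolynomial.aeval y p) := by
    induction p using MvPolynomial.induction_on with
    | C a =>
      rw [ofPoly_C, AlgHom.commutes, ← MvPolynomial.algebraMap_eq, AlgHom.commutes,
        MvPolynomial.algebraMap_eq, ofPoly_C]
    | add p q hp hq => simp only [map_add, hp, hq]
    | mul_X p i hp =>
      rw [map_mul, map_mul, map_mul, map_mul, hp, MvPolynomial.aeval_X, ofPoly_X]
      simp [ψ]
  choose b q hbq using hy
  let mon (t : Fin (n + 2) →₀ ℕ) : MvPolynomial (Fin (n + 1)) (unitBall K) :=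
    ∏ i : Fin (n + 1), MvPolynomial.X i ^ t i.castSucc
  let β (j : Fin s) (t : Fin (n + 2) →₀ ℕ) : DiscSeries K n ρ :=
    ofPoly ρ (b (mon t) j) * X (Fin.last n) ^ t (Fin.last (n + 1))
  let γ (t : Fin (n + 2) →₀ ℕ) : DiscSeries K (n + 1) ρ :=
    ofPoly ρ (q (mon t)) * X (Fin.last (n + 1)) ^ t (Fin.last (n + 1))
  have hbound {m : ℕ} (p : MvPolynomial (Fin m) (unitBall K)) (t : Fin (n + 2) →₀ ℕ) :
      ‖ofPoly ρ p * X (Fin.last m) ^ t (Fin.last (n + 1))‖ ≤ 1 * weight (radius (n + 1) ρ) t := by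
    rw [weight_radius]
    refine (norm_mul_le _ _).trans (mul_le_mul (norm_ofPoly_le p) ((norm_pow_le _ _).trans ?_)
      (norm_nonneg _) zero_le_one)
    rw [norm_X, radius_last]
  have hβ (j t) : ‖β j t‖ ≤ 1 * weight (radius (n + 1) ρ) t := hbound _ t
  have hγ (t) : ‖γ t‖ ≤ 1 * weight (radius (n + 1) ρ) t := hbound _ t
  let L (j : Fin s) : DiscSeries K (n + 1) ρ →ₗ[K] DiscSeries K n ρ := lift (β j) (hβ j)
  let Γ : DiscSeries K (n + 1) ρ →ₗ[K] DiscSeries K (n + 1) ρ := lift γ hγ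
  let Φ : DiscSeries K (n + 1) ρ →+ DiscSeries K (n + 1) ρ :=
    AddMonoidHom.mk' (fun f => ∑ j, ψ (L j f) * X 0 ^ j.1 + Γ f * ofPoly ρ G) fun f f' => by
      simp only [map_add, add_mul, Finset.sum_add_distrib]
      abel
  have hΦc : Continuous Φ := by
    refine Continuous.add (continuous_finsetSum _ fun j _ => ?_) ?_
    · exact (hψc.comp (continuous_lift _ (hβ j))).mul continuous_const
    · exact (continuous_lift _ hγ).mul continuous_const
  -- Exact division by `G`, extended from monomials by continuity: polynomial division in `x` is
  -- integral, so its outputs are bounded by `1`.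
  have hΦ (f) : Φ f = f := by
    suffices h : ∀ t a, Φ (monomial t a) = AddMonoidHom.id _ (monomial t a) from
      DFunLike.congr_fun (addMonoidHom_ext hΦc continuous_id h) f
    intro t a
    change ∑ j, ψ (L j (monomial t a)) * X 0 ^ j.1 + Γ (monomial t a) * ofPoly ρ G = monomial t a
    simp only [L, Γ, lift_monomial, map_smul, smul_mul_assoc]
    rw [← Finset.smul_sum, ← smul_add, monomial_eq_smul t a]
    congr 1
    have key := congrArg (ofPoly ρ) (hbq (mon t))
    rw [monomial_one_eq_ofPoly_mul]
    change _ = ofPoly ρ (mon t) * _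
    rw [key, map_add, map_sum, add_mul, Finset.sum_mul]
    simp only [β, γ, map_mul, map_pow, hψ, hψz, ofPoly_X, Fin.castSucc_zero]
    congr 1
    · exact Finset.sum_congr rfl fun j _ => by ring
    · ring
  refine ⟨ψ, s, hψz, fun h => ?_⟩
  -- Replacing the divisor `G` by `g` changes the identity to `1 - E`, and `E` contracts by `‖G - g‖
  -- < 1`. To divide `h` by `g`, solve `f - E f = h` and use the quotient and remainder of `f` by
  -- `G`.
  let E : DiscSeries K (n + 1) ρ →+ DiscSeries K (n + 1) ρ :=
    AddMonoidHom.mk' (fun f => Γ f * (ofPoly ρ G - g)) fun f f' => by rw [map_add, add_mul]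
  obtain ⟨f, hf⟩ := surjective_sub_of_contraction E hgG (fun f => by
    refine (norm_mul_le _ _).trans ?_
    rw [mul_comm, norm_sub_rev]
    exact mul_le_mul_of_nonneg_left ((norm_lift_le _ hγ f).trans_eq (one_mul _))
      (norm_nonneg _)) h
  refine ⟨fun j => L j f, Γ f, ?_⟩
  have h1 : ∑ j, ψ (L j f) * X 0 ^ j.1 + Γ f * ofPoly ρ G = f := hΦ f
  have h2 : f - Γ f * (ofPoly ρ G - g) = h := hf
  linear_combination -h2 - h1

lemma finite_quotient_comp_of_division {R S : Type*} [CommRing R] [CommRing S] (ψ : R →+* S)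
    {I : Ideal S} {g : S} (hg : g ∈ I) {s : ℕ} (e : Fin s → S)
    (h : ∀ x, ∃ (b : Fin s → R) (q : S), x = ∑ j, ψ (b j) * e j + q * g) :
    ((Ideal.Quotient.mk I).comp ψ).Finite := by
  let : Algebra R (S ⧸ I) := ((Ideal.Quotient.mk I).comp ψ).toAlgebra
  refine Module.Finite.of_surjective
    (Fintype.linearCombination R fun j => Ideal.Quotient.mk I (e j)) fun x => ?_
  obtain ⟨x, rfl⟩ := Ideal.Quotient.mk_surjective x
  obtain ⟨b, q, rfl⟩ := h x
  refine ⟨b, ?_⟩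
  rw [Fintype.linearCombination_apply, map_add, map_sum,
    Ideal.Quotient.eq_zero_iff_mem.2 (I.mul_mem_left q hg), add_zero]
  refine Finset.sum_congr rfl fun j _ => ?_
  rw [Algebra.smul_def, map_mul]
  rfl

/-- The vanishing of the fibres is constant on a punctured neighbourhood of zero. -/
theorem exists_forall_vanishesAt_or_forall_not (d : ℕ) :
    ∀ (ρ : {r : ℝ // 0 < r}) (I : Ideal (DiscSeries K d ρ)), ∃ ε > 0,
      (∀ c, c ≠ 0 → ‖c‖ ≤ ε → VanishesAt I c) ∨ (∀ c, c ≠ 0 → ‖c‖ ≤ ε → ¬ VanishesAt I c) := by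
  induction d with
  | zero =>
    intro ρ I
    by_cases hI : I = ⊥
    · exact ⟨ρ, ρ.2, .inr fun c _ hc => hI ▸ not_vanishesAt_bot hc⟩
    obtain ⟨m, g, hmg, hg, hg'⟩ := exists_normalized_mem hI
    obtain ⟨ρ', h, G, hG, hu, hclose⟩ := exists_poly_close hg hg'
    have hmg' : X (Fin.last 0) ^ m * substLast (X (Fin.last 0)) h g ∈
        I.map (substLast (X (Fin.last 0)) h) := by
      have := Ideal.mem_map_of_mem (substLast (X (Fin.last 0)) h) hmg
      rwa [map_mul, map_pow, substLast_X_last] at this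
    refine ⟨ρ', ρ'.2, .inl fun c hc0 hc => ?_⟩
    rw [← vanishesAt_map_substLast_iff h I hc, ← vanishesAt_sup_span_iff hmg' hc0]
    -- Without variables `x`, `G` is a constant with unit coefficient; hence the nearby `g'` is a
    -- unit and every fibre over the punctured disc vanishes.
    have hunitG : IsUnit G := by
      rw [MvPolynomial.eq_C_of_isEmpty G]
      refine (hu 0 (MvPolynomial.mem_support_iff.2 fun h0 => hG ?_)).map MvPolynomial.C
      rw [MvPolynomial.eq_C_of_isEmpty G, h0, map_zero]
    obtain ⟨G', hG'⟩ := hunitG.exists_right_inv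
    set g' := substLast (X (Fin.last 0)) h g
    have hgu : IsUnit (g' * ofPoly ρ' G') := by
      have h1 : ‖(1 : DiscSeries K 0 ρ') - g' * ofPoly ρ' G'‖ < 1 := by
        rw [← map_one (ofPoly (K := K) (d := 0) ρ'), ← hG', map_mul, ← sub_mul]
        refine (norm_mul_le _ _).trans_lt ?_
        rw [norm_sub_rev] at hclose
        exact (mul_le_of_le_one_right (norm_nonneg _) (norm_ofPoly_le G')).trans_lt hclose
      simpa using isUnit_one_sub_of_norm_lt_one h1
    rw [VanishesAt, Ideal.span_singleton_eq_top.2 (isUnit_of_mul_isUnit_left hgu)]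
    simp
  | succ n ih =>
    intro ρ I
    by_cases hI : I = ⊥
    · exact ⟨ρ, ρ.2, .inr fun c _ hc => hI ▸ not_vanishesAt_bot hc⟩
    obtain ⟨m, g, hmg, hg, hg'⟩ := exists_normalized_mem hI
    obtain ⟨ρ', h, G, hG, hu, hclose⟩ := exists_poly_close hg hg'
    obtain ⟨ψ, s, hψz, hψ⟩ := exists_weierstrass_division hG hu hclose
    have hmg' : X (Fin.last (n + 1)) ^ m * substLast (X (Fin.last (n + 1))) h g ∈
        I.map (substLast (X (Fin.last (n + 1))) h) := by
      have := Ideal.mem_map_of_mem (substLast (X (Fin.last (n + 1))) h) hmg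
      rwa [map_mul, map_pow, substLast_X_last] at this
    set g' := substLast (X (Fin.last (n + 1))) h g
    set I' := I.map (substLast (X (Fin.last (n + 1))) h) ⊔ Ideal.span {g'}
    have hfin := finite_quotient_comp_of_division
      (ψ : DiscSeries K n ρ' →+* DiscSeries K (n + 1) ρ')
      (I := I') (Ideal.mem_sup_right (Ideal.mem_span_singleton_self g'))
      (fun j => X 0 ^ j.1) hψ
    obtain ⟨ε, hε, hJ⟩ := ih ρ' (I'.comap (ψ : DiscSeries K n ρ' →+* DiscSeries K (n + 1) ρ'))
    -- Since `ψ` fixes `z`, extending along `ψ` gives one direction; finiteness modulo `I'` gives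
    -- the other.
    have key (c : K) (hc0 : c ≠ 0) (hc : ‖c‖ ≤ ρ') :
        VanishesAt (I'.comap (ψ : DiscSeries K n ρ' →+* DiscSeries K (n + 1) ρ')) c ↔
          VanishesAt I c := by
      rw [← vanishesAt_map_substLast_iff h I hc, ← vanishesAt_sup_span_iff hmg' hc0]
      refine ⟨fun hv => hv.map ψ (by simp [hψz]) ?_, fun hv => ?_⟩
      · exact Ideal.map_le_iff_le_comap.2 le_rfl
      · refine Ideal.comap_sup_span_eq_top_of_finite _ _ hfin ?_
        simpa [hψz, VanishesAt, I'] using hv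
    refine ⟨min ε ρ', lt_min hε ρ'.2, hJ.imp (fun H c hc0 hc => ?_) fun H c hc0 hc => ?_⟩
    · exact (key c hc0 (hc.trans (min_le_right _ _))).1 (H c hc0 (hc.trans (min_le_left _ _)))
    · rw [← key c hc0 (hc.trans (min_le_right _ _))]
      exact H c hc0 (hc.trans (min_le_left _ _))


/-! ### Openness and uniformity over a complete field. -/

section Complete

variable {K : Type*} [NormedField K] [IsUltrametricDist K] [CompleteSpace K] {d : ℕ}
  {ρ : {r : ℝ // 0 < r}}

lemma isOpen_setOf_vanishesAt (I : Ideal (DiscSeries K d ρ)) : IsOpen {c | VanishesAt I c} := by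
  refine Metric.isOpen_iff.2 fun c hc => ?_
  obtain ⟨i, hi, b, hb, hib⟩ := Submodule.mem_sup.1 ((Ideal.eq_top_iff_one _).1 hc)
  obtain ⟨s, rfl⟩ := Ideal.mem_span_singleton'.1 hb
  have hpos : 0 < ‖s‖ + 1 := by positivity
  -- This radius forces `‖s‖ * ‖c' - c‖ < 1`, so the geometric series inverts `1 - s (c' - c)`; the
  -- `+ 1` covers `s = 0`.
  refine ⟨(‖s‖ + 1)⁻¹, inv_pos.2 hpos, fun c' hc' => ?_⟩
  rw [Metric.mem_ball, dist_eq_norm, ← one_div, lt_div_iff₀ hpos] at hc'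
  have hu : IsUnit (1 - s * algebraMap K _ (c' - c)) := by
    refine isUnit_one_sub_of_norm_lt_one ((norm_mul_le _ _).trans_lt ?_)
    rw [norm_algebraMap', mul_comm]
    exact (mul_le_mul_of_nonneg_left (le_add_of_nonneg_right zero_le_one)
      (norm_nonneg _)).trans_lt hc'
  refine Ideal.eq_top_of_isUnit_mem _ ?_ hu
  rw [← hib, map_sub, show i + s * (X (Fin.last d) - algebraMap K _ c) -
    s * (algebraMap K _ c' - algebraMap K _ c) =
      i + s * (X (Fin.last d) - algebraMap K _ c') by ring]
  exact add_mem (Ideal.mem_sup_left hi)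
    (Ideal.mem_sup_right (Ideal.mul_mem_left _ _ (Ideal.mem_span_singleton_self _)))

/-- The vanishing of the fibres is constant on a punctured neighbourhood of each point of the
disc. -/
lemma exists_vanishesAt_iff_of_dist_lt (I : Ideal (DiscSeries K d ρ)) {a : K} (ha : ‖a‖ ≤ ρ) :
    ∃ ε > 0, ∀ c c', c ≠ a → c' ≠ a → dist c a < ε → dist c' a < ε →
      (VanishesAt I c ↔ VanishesAt I c') := by
  have ha' : ‖X (Fin.last d) + algebraMap K (DiscSeries K d ρ) a‖ ≤ ρ :=
    (IsUltrametricDist.norm_add_le_max _ _).trans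
      (max_le (by simp [norm_X]) (norm_algebraMap_le ha))
  obtain ⟨ε, hε, H⟩ := exists_forall_vanishesAt_or_forall_not d ρ
    (I.map (substLast (X (Fin.last d) + algebraMap K (DiscSeries K d ρ) a) ha'))
  have key (c) (hc : c ≠ a) (hcε : dist c a < ε) := And.intro (sub_ne_zero.2 hc)
    (dist_eq_norm c a ▸ hcε.le)
  simp only [vanishesAt_map_translate_iff] at H
  refine ⟨ε, hε, fun c c' hc hc' hd hd' => ?_⟩
  obtain H | H := H
  · exact iff_of_true (by simpa using H (c - a) (key c hc hd).1 (key c hc hd).2)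
      (by simpa using H (c' - a) (key c' hc' hd').1 (key c' hc' hd').2)
  · exact iff_of_false (by simpa using H (c - a) (key c hc hd).1 (key c hc hd).2)
      (by simpa using H (c' - a) (key c' hc' hd').1 (key c' hc' hd').2)

/-- On a compact subset of the disc, the vanishing of the fibres is uniformly locally constant
outside a finite set. -/
theorem exists_finite_vanishesAt_iff (I : Ideal (DiscSeries K d ρ)) {S : Set K} (hS : IsCompact S)
    (hSρ : ∀ c ∈ S, ‖c‖ ≤ ρ) :
    ∃ ε > 0, ∃ F : Set K, F.Finite ∧ ∀ c ∈ S, ∀ c' ∈ S, c ∉ F → c' ∉ F → dist c' c < ε →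
      (VanishesAt I c ↔ VanishesAt I c') := by
  choose! ε hε H using fun a ha => exists_vanishesAt_iff_of_dist_lt I (hSρ a ha)
  obtain ⟨t, htS, ht⟩ := hS.elim_nhds_subcover (fun a => Metric.ball a (ε a))
    fun a ha => Metric.ball_mem_nhds a (hε a ha)
  obtain ⟨δ, hδ, hball⟩ := lebesgue_number_lemma_of_metric (c := fun a : t => Metric.ball a.1 (ε a))
    hS (fun _ => Metric.isOpen_ball) (by simpa [Set.iUnion_subtype] using ht)
  -- The exceptional set is the set of centres of the subcover: any other two points at distance
  -- less than `δ` lie in a common punctured ball.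
  refine ⟨δ, hδ, t, t.finite_toSet, fun c hc c' _ hcF hcF' hcc' => ?_⟩
  obtain ⟨⟨a, ha⟩, hca⟩ := hball c hc
  exact H a (htS a ha) c c' (fun h => hcF (h ▸ ha)) (fun h => hcF' (h ▸ ha))
    (hca (Metric.mem_ball_self hδ)) (hca hcc')

end Complete

/-! ### Descent from the completion of `K`. -/

section Completion

open UniformSpace (Completion)

variable {K : Type*} [NormedField K] [IsUltrametricDist K]

instance : IsUltrametricDist (Completion K) :=
  IsUltrametricDist.isUltrametricDist_of_forall_norm_natCast_le_one fun n => by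
    have := Completion.norm_coe (n : K)
    rw [show ((n : K) : Completion K) = n from
      map_natCast (Completion.coeRingHom (α := K)) n] at this
    rw [this]
    exact IsUltrametricDist.norm_natCast_le_one K n

variable {d : ℕ}

lemma weight_radius_one (t : Fin (d + 1) →₀ ℕ) : weight (radius d ⟨1, one_pos⟩) t = 1 := by
  simp [weight_radius]

variable (K d) in
/-- The map from the Tate algebra over `K` to the Tate algebra over the completion of `K`. -/
noncomputable def ofTateAlgebra :
    TateAlgebra K (Fin (d + 1)) →+* DiscSeries (Completion K) d ⟨1, one_pos⟩ :=
  ((MvPowerSeries.map (Completion.coeRingHom (α := K))).comp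
    (TateAlgebra K (Fin (d + 1))).subtype).codRestrict _ fun f => by
      have h := (TateAlgebra.mem_iff f.1).1 f.2
      refine h.congr fun t => ?_
      change _ = ‖((MvPowerSeries.coeff t f.1 : K) : Completion K)‖ * weight (radius d _) t
      rw [weight_radius_one, mul_one, Completion.norm_coe]

lemma ofTateAlgebra_var (i : Fin (d + 1)) : ofTateAlgebra K d (TateAlgebra.var i) = X i := by
  refine Subtype.ext ?_
  exact MvPowerSeries.map_X (Completion.coeRingHom (α := K)) i

lemma ofTateAlgebra_const (c : K) :
    ofTateAlgebra K d (TateAlgebra.const c) = algebraMap (Completion K) _ (c : Completion K) := by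
  refine Subtype.ext ?_
  exact MvPowerSeries.map_C (Completion.coeRingHom (α := K)) c

lemma denseRange_ofTateAlgebra : DenseRange (ofTateAlgebra K d) := by
  classical
  let T := (ofTateAlgebra K d).range.topologicalClosure
  have hT : IsClosed (T : Set (DiscSeries (Completion K) d ⟨1, one_pos⟩)) :=
    Subring.isClosed_topologicalClosure _
  have hmon (t) (a : Completion K) : monomial t a ∈ T := by
    have hcont : Continuous fun a : Completion K =>
        (monomial t a : DiscSeries (Completion K) d ⟨1, one_pos⟩) := by
      rw [funext (monomial_eq_smul (c := radius d ⟨1, one_pos⟩) t)]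
      exact continuous_id.smul continuous_const
    refine Completion.induction_on a (hT.preimage hcont) fun a => ?_
    refine Subring.le_topologicalClosure _
      ⟨⟨MvPowerSeries.monomial t a, MvPowerSeries.isRestricted_monomial _ t a⟩, Subtype.ext ?_⟩
    exact MvPowerSeries.map_monomial (Completion.coeRingHom (α := K)) t a
  intro f
  exact hT.mem_of_tendsto (hasSum_monomial f)
    (Eventually.of_forall fun s => sum_mem fun t _ => hmon t _)

/-- The inverse exists over the completion by the geometric series. It already has coefficients in
`K`, because it is also the formal inverse over `K`; and they tend to zero since the embedding
preserves norms. -/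
lemma isUnit_of_norm_ofTateAlgebra_sub_one_lt {u : TateAlgebra K (Fin (d + 1))}
    (hu : ‖ofTateAlgebra K d u - 1‖ < 1) : IsUnit u := by
  have hunit : IsUnit (ofTateAlgebra K d u) := by
    rw [norm_sub_rev] at hu
    simpa using isUnit_one_sub_of_norm_lt_one hu
  obtain ⟨v, hv⟩ := hunit.exists_right_inv
  have hv' : MvPowerSeries.map (Completion.coeRingHom (α := K)) u.1 * v.1 = 1 :=
    congrArg Subtype.val hv
  have h0 : IsUnit (MvPowerSeries.constantCoeff u.1) := by
    refine isUnit_iff_ne_zero.2 fun h => ?_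
    have h1 := congrArg MvPowerSeries.constantCoeff hv'
    rw [map_mul, MvPowerSeries.constantCoeff_map, h, map_zero, zero_mul, map_one] at h1
    exact zero_ne_one h1
  obtain ⟨w, hw⟩ := (MvPowerSeries.isUnit_iff_constantCoeff.2 h0).exists_right_inv
  have hwv : MvPowerSeries.map (Completion.coeRingHom (α := K)) w = v.1 := by
    have h1 := congrArg (MvPowerSeries.map (Completion.coeRingHom (α := K))) hw
    rw [map_mul, map_one] at h1
    calc _ = MvPowerSeries.map (Completion.coeRingHom (α := K)) w *
          (MvPowerSeries.map (Completion.coeRingHom (α := K)) u.1 * v.1) := by rw [hv', mul_one]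
      _ = v.1 := by rw [← mul_assoc, mul_comm (MvPowerSeries.map _ w), h1, one_mul]
  have hwr : w ∈ TateAlgebra K (Fin (d + 1)) := by
    refine (TateAlgebra.mem_iff w).2 ((tendsto_coeff v).congr fun t => ?_)
    rw [weight_radius_one, mul_one, coeff, ← hwv, MvPowerSeries.coeff_map]
    exact Completion.norm_coe _
  exact .of_mul_eq_one ⟨w, hwr⟩ (Subtype.ext hw)

/-- An ideal generating the unit ideal over the completion is the unit ideal. -/
lemma eq_top_of_map_ofTateAlgebra_eq_top {I : Ideal (TateAlgebra K (Fin (d + 1)))}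
    (hI : I.map (ofTateAlgebra K d) = ⊤) : I = ⊤ := by
  -- By density the coefficients in a combination can be approximated from `K`, so the extended
  -- ideal lies in the closure of the image of `I`; applied to `1`, this produces a unit in `I`.
  have hmem : ∀ x ∈ I.map (ofTateAlgebra K d),
      x ∈ closure (ofTateAlgebra K d '' (I : Set (TateAlgebra K (Fin (d + 1))))) := by
    intro x hx
    induction hx using Submodule.span_induction with
    | mem x hx => exact subset_closure hx
    | zero => exact subset_closure ⟨0, I.zero_mem, map_zero _⟩
    | add x y _ _ hx hy =>
      refine map_mem_closure₂ continuous_add hx hy ?_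
      rintro _ ⟨a, ha, rfl⟩ _ ⟨b, hb, rfl⟩
      exact ⟨a + b, I.add_mem ha hb, map_add _ _ _⟩
    | smul a x _ hx =>
      refine map_mem_closure₂ continuous_mul (denseRange_ofTateAlgebra a) hx ?_
      rintro _ ⟨a, rfl⟩ _ ⟨b, hb, rfl⟩
      exact ⟨a * b, I.mul_mem_left _ hb, map_mul _ _ _⟩
  obtain ⟨_, ⟨u, hu, rfl⟩, hu1⟩ := Metric.mem_closure_iff.1 (hmem 1 (hI ▸ trivial)) 1 one_pos
  rw [dist_comm, dist_eq_norm] at hu1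
  exact I.eq_top_of_isUnit_mem hu (isUnit_of_norm_ofTateAlgebra_sub_one_lt hu1)

lemma mem_vanishingSet_iff (M : Type*) [AddCommGroup M] [Module (TateAlgebra K (Fin (d + 1))) M]
    [Module.Finite (TateAlgebra K (Fin (d + 1))) M] (c : K) :
    c ∈ vanishingSet K d M ↔
      VanishesAt ((Module.annihilator (TateAlgebra K (Fin (d + 1))) M).map (ofTateAlgebra K d))
        (c : Completion K) := by
  refine (Module.subsingleton_quotient_smul_top_iff _).trans ?_
  have hmap : (Module.annihilator (TateAlgebra K (Fin (d + 1))) M ⊔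
      Ideal.span {TateAlgebra.var (Fin.last d) - TateAlgebra.const c}).map (ofTateAlgebra K d) =
      (Module.annihilator (TateAlgebra K (Fin (d + 1))) M).map (ofTateAlgebra K d) ⊔
        Ideal.span {X (Fin.last d) - algebraMap (Completion K) _ (c : Completion K)} := by
    rw [Ideal.map_sup, Ideal.map_span, Set.image_singleton, map_sub, ofTateAlgebra_var,
      ofTateAlgebra_const]
  rw [VanishesAt, ← hmap]
  exact ⟨fun h => by rw [h, Ideal.map_top], eq_top_of_map_ofTateAlgebra_eq_top⟩

end Completion

end restrictedSeries

/-! ### Integers in the `p`-adic metric. -/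

section Integers

variable {p : ℕ} {L : Type*} [NormedField L] [IsUltrametricDist L]

lemma norm_intCast_le_of_dvd (hp : ‖(p : L)‖ = (p : ℝ)⁻¹) {r : ℕ} {n : ℤ} (h : (p : ℤ) ^ r ∣ n) :
    ‖(n : L)‖ ≤ (p : ℝ)⁻¹ ^ r := by
  obtain ⟨m, rfl⟩ := h
  rw [Int.cast_mul, norm_mul, Int.cast_pow, norm_pow, Int.cast_natCast, hp]
  exact mul_le_of_le_one_right (by positivity) (IsUltrametricDist.norm_intCast_le_one L m)

variable [Fact p.Prime]

lemma inv_prime_lt_one : (p : ℝ)⁻¹ < 1 :=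
  inv_lt_one_of_one_lt₀ (by exact_mod_cast (Fact.out : p.Prime).one_lt)

lemma intCast_injective_of_norm_prime (hp : ‖(p : L)‖ = (p : ℝ)⁻¹) :
    Function.Injective (Int.cast : ℤ → L) := by
  have hp0 : (p : L) ≠ 0 := by
    rw [← norm_pos_iff, hp, inv_pos]
    exact_mod_cast (Fact.out : p.Prime).pos
  refine (injective_iff_map_eq_zero (Int.castRingHom L)).2 fun n hn => ?_
  by_contra hn0
  -- A nonzero `n` in the kernel would give an `m` prime to `p` that vanishes in `L`; Bézout then
  -- makes `p` invertible by an integer, against `‖p‖ < 1`.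
  obtain ⟨k, m, hm, rfl⟩ : ∃ (k : ℕ) (m : ℤ), ¬ (p : ℤ) ∣ m ∧ n = p ^ k * m := by
    have hfin : FiniteMultiplicity (p : ℤ) n :=
      Int.finiteMultiplicity_iff.2 ⟨by simpa using (Fact.out : p.Prime).one_lt.ne', hn0⟩
    obtain ⟨m, hm, hm'⟩ := hfin.exists_eq_pow_mul_and_not_dvd
    exact ⟨_, m, hm', hm⟩
  have hm0 : (m : L) = 0 := by simpa [hp0] using hn
  have hcop : IsCoprime (p : ℤ) m :=
    ((Nat.prime_iff_prime_int.1 Fact.out).coprime_iff_not_dvd).2 hm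
  obtain ⟨a, b, hab⟩ := hcop
  have h1 : (a : L) * p = 1 := by
    have := congrArg (Int.cast : ℤ → L) hab
    push_cast at this
    rwa [hm0, mul_zero, add_zero] at this
  have h2 : ‖(a : L) * p‖ < 1 := by
    rw [norm_mul, hp]
    exact (mul_le_of_le_one_left (by positivity)
      (IsUltrametricDist.norm_intCast_le_one L a)).trans_lt inv_prime_lt_one
  rw [h1, norm_one] at h2
  exact lt_irrefl _ h2

lemma isCompact_closure_range_intCast [CompleteSpace L] (hp : ‖(p : L)‖ = (p : ℝ)⁻¹) :
    IsCompact (closure (Set.range (Int.cast : ℤ → L))) := by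
  refine isCompact_iff_totallyBounded_isComplete.2
    ⟨TotallyBounded.closure ?_, isClosed_closure.isComplete⟩
  refine Metric.totallyBounded_iff.2 fun ε hε => ?_
  obtain ⟨r, hr⟩ := exists_pow_lt_of_lt_one hε (inv_prime_lt_one (p := p))
  refine ⟨Int.cast '' Set.Ico (0 : ℤ) ((p : ℤ) ^ r), (Set.finite_Ico _ _).image _, ?_⟩
  rintro _ ⟨n, rfl⟩
  have hpos : (0 : ℤ) < (p : ℤ) ^ r := pow_pos (by exact_mod_cast (Fact.out : p.Prime).pos) r
  simp only [Set.mem_iUnion]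
  refine ⟨_, ⟨n % (p : ℤ) ^ r, ⟨Int.emod_nonneg _ hpos.ne', Int.emod_lt_of_pos _ hpos⟩, rfl⟩, ?_⟩
  rw [Metric.mem_ball, dist_eq_norm, ← Int.cast_sub]
  exact (norm_intCast_le_of_dvd hp (Int.dvd_self_sub_emod)).trans_lt hr

end Integers

/-! ### The theorem. -/

open restrictedSeries in
theorem theoremA1 (p : ℕ) [Fact p.Prime]
    (K : Type*) [NormedField K] [IsUltrametricDist K] (hp : ‖(p : K)‖ = (p : ℝ)⁻¹)
    (d : ℕ) (M : Type*) [AddCommGroup M] [Module (TateAlgebra K (Fin (d + 1))) M]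
    [Module.Finite (TateAlgebra K (Fin (d + 1))) M] :
    (∀ R : Subring K, (∀ c ∈ R, ‖c‖ ≤ 1) →
      IsOpen {c : R | (c : K) ∈ vanishingSet K d M} ∧
      (CompactSpace R →
        ∃ ε : ℝ, 0 < ε ∧ ∃ C : Set R,
          EqUpToFinite {c : R | (c : K) ∈ vanishingSet K d M} (⋃ a ∈ C, Metric.ball a ε))) ∧
    (∃ r : ℕ, ∃ B : Finset ℤ,
      EqUpToFinite {n : ℤ | (n : K) ∈ vanishingSet K d M}
        (⋃ b ∈ B, {n : ℤ | n ≡ b [ZMOD (p : ℤ) ^ r]})) := by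
  simp only [mem_vanishingSet_iff]
  set I := (Module.annihilator (TateAlgebra K (Fin (d + 1))) M).map (ofTateAlgebra K d)
  refine ⟨fun R hR => ?_, ?_⟩
  · let ι : R → UniformSpace.Completion K := fun c => ((c : K) : UniformSpace.Completion K)
    have hdist (a b : R) : dist (ι a) (ι b) = dist a b := UniformSpace.Completion.dist_eq _ _
    have hι : Isometry ι := Isometry.of_dist_eq hdist
    refine ⟨(isOpen_setOf_vanishesAt I).preimage hι.continuous, fun _ => ?_⟩
    obtain ⟨ε, hε, F, hF, H⟩ := exists_finite_vanishesAt_iff I (isCompact_range hι.continuous) (by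
      rintro _ ⟨c, rfl⟩
      exact (UniformSpace.Completion.norm_coe _).trans_le (hR c c.2))
    -- Exceptional points are not allowed as centres: their behaviour says nothing about their ball.
    refine ⟨ε, hε, {a | VanishesAt I (ι a) ∧ ι a ∉ F},
      (hF.preimage hι.injective.injOn).subset ?_⟩
    rintro c (⟨hc, hc'⟩ | ⟨hc, hc'⟩)
    · by_contra hcF
      refine hc' (Set.mem_biUnion (x := c) ⟨hc, hcF⟩ (Metric.mem_ball_self hε))
    · by_contra hcF
      obtain ⟨a, ⟨ha, haF⟩, hca⟩ := Set.mem_iUnion₂.1 hc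
      exact hc' ((H _ ⟨a, rfl⟩ _ ⟨c, rfl⟩ haF hcF ((hdist c a).trans_lt hca)).1 ha)
  · have hp' : ‖(p : UniformSpace.Completion K)‖ = (p : ℝ)⁻¹ := by
      rw [← hp, ← UniformSpace.Completion.norm_coe (p : K)]
      exact congrArg norm (map_natCast (UniformSpace.Completion.coeRingHom (α := K)) p).symm
    have hcast (n : ℤ) : ((n : K) : UniformSpace.Completion K) = n :=
      map_intCast (UniformSpace.Completion.coeRingHom (α := K)) n
    simp only [hcast]
    obtain ⟨ε, hε, F, hF, H⟩ := exists_finite_vanishesAt_iff I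
      (isCompact_closure_range_intCast hp') fun c hc => by
        refine closure_minimal (t := {c | ‖c‖ ≤ 1}) ?_
          (isClosed_le continuous_norm continuous_const) hc
        rintro _ ⟨n, rfl⟩
        exact IsUltrametricDist.norm_intCast_le_one _ n
    obtain ⟨r, hr⟩ := exists_pow_lt_of_lt_one hε (inv_prime_lt_one (p := p))
    have hpos : (0 : ℤ) < (p : ℤ) ^ r := pow_pos (by exact_mod_cast (Fact.out : p.Prime).pos) r
    have H' (m n : ℤ) (hm : (m : UniformSpace.Completion K) ∉ F)
        (hn : (n : UniformSpace.Completion K) ∉ F) (hmn : n ≡ m [ZMOD (p : ℤ) ^ r]) :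
        VanishesAt I (m : UniformSpace.Completion K) ↔
          VanishesAt I (n : UniformSpace.Completion K) := by
      refine H _ (subset_closure ⟨m, rfl⟩) _ (subset_closure ⟨n, rfl⟩) hm hn ?_
      rw [dist_eq_norm, ← Int.cast_sub]
      exact (norm_intCast_le_of_dvd hp' hmn.symm.dvd).trans_lt hr
    classical
    -- A residue is kept when its class has a non-exceptional vanishing member `m`; `b` itself may
    -- be exceptional, so `m` serves for the comparison.
    refine ⟨r, (Finset.Ico 0 ((p : ℤ) ^ r)).filter fun b => ∃ m : ℤ, m ≡ b [ZMOD (p : ℤ) ^ r] ∧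
      VanishesAt I (m : UniformSpace.Completion K) ∧ (m : UniformSpace.Completion K) ∉ F,
      (hF.preimage (intCast_injective_of_norm_prime hp').injOn).subset ?_⟩
    rintro n (⟨hn, hn'⟩ | ⟨hn, hn'⟩)
    · by_contra hnF
      have hmod : n ≡ n % (p : ℤ) ^ r [ZMOD (p : ℤ) ^ r] := (Int.mod_modEq _ _).symm
      refine hn' (Set.mem_biUnion (x := n % (p : ℤ) ^ r) ?_ hmod)
      rw [Finset.mem_coe, Finset.mem_filter, Finset.mem_Ico]
      exact ⟨⟨Int.emod_nonneg _ hpos.ne', Int.emod_lt_of_pos _ hpos⟩, n, hmod, hn, hnF⟩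
    · by_contra hnF
      obtain ⟨b, hb, hnb⟩ := Set.mem_iUnion₂.1 hn
      obtain ⟨-, m, hmb, hm, hmF⟩ := Finset.mem_filter.1 hb
      exact hn' ((H' m n hmF hnF (Int.ModEq.trans hnb hmb.symm)).1 hm)
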